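/- Let $k$ be a field, let $\mathbb{S}^1=\mathbb{R}/2\pi\mathbb{Z}$ be the circle and let $e\colon\mathbb{R}\to\mathbb{S}^1$ be the quotient map. A sheaf $F$ of $k$-vector spaces on $\mathbb{S}^1$ is called constructible if there is a real analytic stratification of $\mathbb{S}^1$ (a locally finite partition into connected real analytic submanifolds, that is, into points and connected open subsets) such that the restriction of $F$ to each stratum is a constant sheaf of finite rank. For an interval $I\subset\mathbb{R}$ and $n\in\mathbb{N}$ let $k^n_I$ be the sheaf on $\mathbb{R}$ obtained by extending by zero the constant sheaf with fibre $k^n$ on $I$. Let $F$ be a constructible sheaf of $k$-vector spaces on $\mathbb{S}^1$. Then there exist a finite family $\{(I_a,n_a)\}_{a\in A}$, where each $I_a$ is a (nonempty) bounded interval of $\mathbb{R}$ (open, closed or half-open, possibly reduced to a point) and $n_a\in\mathbb{N}$, and a locally constant sheaf $L$ of $k$-vector spaces of finite rank on $\mathbb{S}^1$, such that $$F \simeq L \oplus \bigoplus_{a\in A} e_*\bigl(k^{n_a}_{I_a}\bigr).$$ -/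

import Mathlib

open CategoryTheory CategoryTheory.Limits TopologicalSpace Topology

namespace CircleSheaf

universe u

noncomputable section

/-! ### Restriction to subsets, constant and locally constant sheaves -/

/-- The category of sheaves of `k`-vector spaces on a topological space `X`. -/
abbrev Sh (k : Type u) [Field k] (X : TopCat.{u}) :=
  TopCat.Sheaf (ModuleCat.{u} k) X

instance hasFiniteBiproducts_sh (k : Type u) [Field k] (X : TopCat.{u}) :
    HasFiniteBiproducts (Sh k X) :=
  Abelian.hasFiniteBiproducts

/-- The inclusion of a subset, with the subspace topology. -/
def incl {X : TopCat.{u}} (Z : Set X) : TopCat.of Z ⟶ X :=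
  TopCat.ofHom ⟨Subtype.val, continuous_subtype_val⟩

/-- The restriction `F|_Z` (inverse image) of a sheaf to a subset `Z`. -/
def restrict {k : Type u} [Field k] {X : TopCat.{u}} (F : Sh k X) (Z : Set X) :
    Sh k (TopCat.of Z) :=
  (TopCat.Sheaf.pullback (ModuleCat.{u} k) (incl Z)).obj F

/-- `F` is isomorphic to the constant sheaf associated with a finite-dimensional vector space. -/
def IsConstantOfFiniteRank {k : Type u} [Field k] {X : TopCat.{u}} (F : Sh k X) : Prop :=
  ∃ M : ModuleCat.{u} k, Module.Finite k M ∧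
    Nonempty (F ≅ (constantSheaf (Opens.grothendieckTopology X) (ModuleCat.{u} k)).obj M)

/-- Every point has an open neighbourhood on which `F` is constant of finite rank. -/
def IsLocallyConstantOfFiniteRank {k : Type u} [Field k] {X : TopCat.{u}} (F : Sh k X) : Prop :=
  ∀ x : X, ∃ U : Set X, IsOpen U ∧ x ∈ U ∧ IsConstantOfFiniteRank (restrict F U)

/-! ### Constructible sheaves on a one-dimensional real analytic manifold -/

/-- Stratifications of a one-dimensional real analytic manifold `X`: locally finite partitions of
`X` into (nonempty) connected real analytic submanifolds. In dimension one the connected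
submanifolds are the points and the connected open subsets, and the closure of a stratum is
automatically a union of strata. -/
structure IsStratification {X : Type u} [TopologicalSpace X] (S : Set (Set X)) : Prop where
  isPartition : Setoid.IsPartition S
  locallyFinite : LocallyFinite (fun s : S => (s : Set X))
  isConnected : ∀ s ∈ S, IsConnected s
  point_or_open : ∀ s ∈ S, (∃ x, s = {x}) ∨ IsOpen s

/-- A sheaf on a one-dimensional real analytic manifold is constructible if there is a
stratification such that the restriction of the sheaf to each stratum is constant of finite rank. -/
def IsConstructible {k : Type u} [Field k] {X : TopCat.{u}} (F : Sh k X) : Prop :=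
  ∃ S : Set (Set X), IsStratification S ∧ ∀ s ∈ S, IsConstantOfFiniteRank (restrict F s)

/-! ### The sheaf `V_Z`: the constant sheaf on a locally closed subset, extended by zero -/

/-- The functions `f : U → V` that represent the sections over the open set `U` of the extension by
zero of the constant sheaf `V` on `Z`: `f` is zero outside `Z`, its restriction to `U ∩ Z` is
locally constant, and its support is closed in `U`. -/
structure IsExtSection {X : Type u} [TopologicalSpace X] (Z : Set X) {V : Type u} [Zero V]
    {U : Set X} (f : U → V) : Prop where
  zero_off : ∀ x : U, x.1 ∉ Z → f x = 0
  locConst : IsLocallyConstant (fun x : {x : U // x.1 ∈ Z} => f x.1)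
  closed_support : IsClosed (Function.support f)

theorem isExtSection_iff {X : Type u} [TopologicalSpace X] (Z : Set X) {V : Type u} [Zero V]
    {U : Set X} (f : U → V) :
    IsExtSection Z f ↔ ∀ x : U, (x.1 ∉ Z → ∀ᶠ y in 𝓝 x, f y = 0) ∧
      (x.1 ∈ Z → ∀ᶠ y in 𝓝 x, y.1 ∈ Z → f y = f x) := by
  constructor
  · intro h x
    refine ⟨fun hx => ?_, fun hx => ?_⟩
    · have h1 : x ∈ (Function.support f)ᶜ := by simpa using h.zero_off x hx
      filter_upwards [h.closed_support.isOpen_compl.mem_nhds h1] with y hy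
      simpa using hy
    · have h1 := (IsLocallyConstant.iff_eventually_eq _).1 h.locConst ⟨x, hx⟩
      rw [nhds_subtype_eq_comap, Filter.eventually_comap] at h1
      filter_upwards [h1] with y hy hyZ
      exact hy ⟨y, hyZ⟩ rfl
  · intro h
    refine ⟨fun x hx => ((h x).1 hx).self_of_nhds, ?_, ?_⟩
    · rw [IsLocallyConstant.iff_eventually_eq]
      rintro ⟨x, hx⟩
      rw [nhds_subtype_eq_comap, Filter.eventually_comap]
      filter_upwards [(h x).2 hx] with y hy
      rintro ⟨z, hz⟩ rfl
      exact hy hz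
    · rw [← isOpen_compl_iff, isOpen_iff_mem_nhds]
      intro x hx
      have hx0 : f x = 0 := by simpa using hx
      by_cases hZ : x.1 ∈ Z
      · filter_upwards [(h x).2 hZ] with y hy
        by_cases hyZ : y.1 ∈ Z
        · simp [hy hyZ, hx0]
        · simp [((h y).1 hyZ).self_of_nhds]
      · filter_upwards [(h x).1 hZ] with y hy
        simp [hy]

/-- The property `IsExtSection` is local on `U`. -/
def extLocalPredicate (X : TopCat.{u}) (Z : Set X) (V : Type u) [Zero V] :
    TopCat.LocalPredicate (fun _ : X => V) where
  pred {U} f := IsExtSection Z (U := (U : Set X)) f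
  res {U W} i f h := by
    rw [isExtSection_iff] at h ⊢
    intro x
    have hc : Filter.Tendsto (fun y : U => (⟨y.1, i.le y.2⟩ : W)) (𝓝 x) (𝓝 ⟨x.1, i.le x.2⟩) :=
      (continuous_inclusion i.le).tendsto x
    exact ⟨fun hx => hc.eventually ((h _).1 hx), fun hx => hc.eventually ((h _).2 hx)⟩
  locality {U} f w := by
    rw [isExtSection_iff]
    intro x
    obtain ⟨W, hx, i, h⟩ := w x
    rw [isExtSection_iff] at h
    have hm : Filter.map (fun y : W => (⟨y.1, i.le y.2⟩ : U)) (𝓝 ⟨x.1, hx⟩) = 𝓝 x :=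
      (Opens.isOpenEmbedding_of_le i.le).map_nhds_eq ⟨x.1, hx⟩
    rw [← hm]
    exact ⟨fun hz => (h ⟨x.1, hx⟩).1 hz, fun hz => (h ⟨x.1, hx⟩).2 hz⟩

/-- The vector space of sections over `U` of the extension by zero of the constant sheaf `V`
on `Z`. -/
def extSections (k : Type u) [Field k] (X : TopCat.{u}) (Z : Set X) (V : Type u)
    [AddCommGroup V] [Module k V] (U : Opens X) : Submodule k (U → V) where
  carrier := {f | (extLocalPredicate X Z V).pred f}
  zero_mem' := by
    refine (isExtSection_iff Z _).2 fun x => ?_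
    simp
  add_mem' {f g} hf hg := by
    refine (isExtSection_iff Z _).2 fun x => ⟨fun hx => ?_, fun hx => ?_⟩
    · filter_upwards [((isExtSection_iff Z _).1 hf x).1 hx,
        ((isExtSection_iff Z _).1 hg x).1 hx] with y h1 h2
      simp [h1, h2]
    · filter_upwards [((isExtSection_iff Z _).1 hf x).2 hx,
        ((isExtSection_iff Z _).1 hg x).2 hx] with y h1 h2 hy
      simp [h1 hy, h2 hy]
  smul_mem' c f hf := by
    refine (isExtSection_iff Z _).2 fun x => ⟨fun hx => ?_, fun hx => ?_⟩
    · filter_upwards [((isExtSection_iff Z _).1 hf x).1 hx] with y h1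
      simp [h1]
    · filter_upwards [((isExtSection_iff Z _).1 hf x).2 hx] with y h1 hy
      simp [h1 hy]

/-- The underlying presheaf of `V_Z`; the restriction maps are the restrictions of functions. -/
def extPresheaf (k : Type u) [Field k] (X : TopCat.{u}) (Z : Set X) (V : Type u)
    [AddCommGroup V] [Module k V] : TopCat.Presheaf (ModuleCat.{u} k) X where
  obj U := ModuleCat.of k (extSections k X Z V U.unop)
  map {U W} i := ModuleCat.ofHom
    { toFun := fun f => ⟨fun x => f.1 ⟨x.1, i.unop.le x.2⟩,
        (extLocalPredicate X Z V).res i.unop f.1 f.2⟩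
      map_add' := fun _ _ => rfl
      map_smul' := fun _ _ => rfl }

theorem extPresheaf_isSheaf (k : Type u) [Field k] (X : TopCat.{u}) (Z : Set X) (V : Type u)
    [AddCommGroup V] [Module k V] : (extPresheaf k X Z V).IsSheaf :=
  (TopCat.Presheaf.isSheaf_iff_isSheaf_comp (forget (ModuleCat.{u} k)) _).2
    (TopCat.subpresheafToTypes.isSheaf (extLocalPredicate X Z V))

/-- The sheaf `V_Z` on `X`, for `Z` locally closed in `X`: the constant sheaf with fibre `V` on `Z`,
extended by zero to `X`. -/
def extSheaf (k : Type u) [Field k] (X : TopCat.{u}) (Z : Set X) (V : Type u)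
    [AddCommGroup V] [Module k V] : Sh k X :=
  ⟨extPresheaf k X Z V, extPresheaf_isSheaf k X Z V⟩

/-! ### The line, the circle and the quotient map -/

/-- The real line (lifted to the universe of the coefficient field). -/
def line : TopCat.{u} := TopCat.of (ULift.{u} ℝ)

/-- The circle `ℝ / 2πℤ` (lifted to the universe of the coefficient field). -/
def circle : TopCat.{u} := TopCat.of (ULift.{u} (AddCircle (2 * Real.pi)))

/-- The quotient map `e : ℝ → ℝ / 2πℤ`. -/
def e : line.{u} ⟶ circle.{u} :=
  TopCat.ofHom ⟨fun x => ULift.up (x.down : AddCircle (2 * Real.pi)),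
    continuous_uliftUp.comp ((AddCircle.continuous_mk' (2 * Real.pi)).comp continuous_uliftDown)⟩

/-- The sheaf `k^n_I` on the real line. -/
def intervalSheaf (k : Type u) [Field k] (I : Set ℝ) (n : ℕ) : Sh k line.{u} :=
  extSheaf k line.{u} (ULift.down ⁻¹' I) (Fin n → k)

/-- Bounded (nonempty) intervals of `ℝ`: open, closed or half-open, including one-point ones. -/
structure IsBoundedInterval (I : Set ℝ) : Prop where
  nonempty : I.Nonempty
  ordConnected : I.OrdConnected
  isBounded : Bornology.IsBounded I

/-- The direct image functor `e_*`. -/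
abbrev eDirectImage (k : Type u) [Field k] : Sh k line.{u} ⥤ Sh k circle.{u} :=
  TopCat.Sheaf.pushforward (ModuleCat.{u} k) e

end

end CircleSheaf

/-! Lift a grid on the circle to a periodic grid on the line whose even points include all lifts of
point strata. The spaces of sections over the stars of the grid points form a bi-infinite periodic
chain of finite-dimensional spaces, consecutive ones being joined by the linear relation of agreeing
on the overlap. Constructibility makes each relation the graph of a linear map, to the right at even
indices and to the left at odd ones (`IsConstructible.exists_adapted`, `Adapted.exists_right`,
`Adapted.exists_left`).

If every relation, read from left to right, is single-valued and onto, dimensions cannot grow along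
the chain, so periodicity makes all relations bijective (`LinRel.bijective_of_periodic`) and the
sheaf is locally constant. Its monodromy is arbitrary and stays inside `L`. Otherwise a defect
recurs infinitely often. If no bar starting at a defect ever ended, the subspaces reached from
successive defects would have strictly monotone dimensions, against boundedness
(`LinRel.reach_lt_or_exists_end`). Hence there is a string: a finite chain of vectors and a chain of
functionals, pairing to one, with end conditions that let each be used on the line.

A string gives a bounded interval `I`, a section of the inverse image of `F` supported in `I`, and a
morphism from that inverse image to the constant sheaf on `I` (`SplitData`). These induce maps
between `F` and the direct image of `k_I`. Since `I` may wrap around the circle, the composite on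
this direct image need not be the identity; but it is unitriangular along the fibres of `e`, hence
invertible (`SplitData.fromPush_toPush_bijective`). So the direct image is a direct summand. Its
complement is a retract of `F`, is adapted to the same grid and has smaller total rank, and
induction ends the proof (`Adapted.exists_decomposition`). -/

namespace CircleSheaf

/-! ### Chains of linear relations -/

namespace LinRel

universe v

variable {k : Type*} [Field k] {X : ℤ → Type v} [∀ i, AddCommGroup (X i)] [∀ i, Module k (X i)]

/-- The elements of `X n` that can be reached from `S ≤ X a` along the relations `C`. -/
def reach (C : ∀ i, Submodule k (X i × X (i + 1))) (a : ℤ) (S : Submodule k (X a)) (n : ℤ) :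
    Submodule k (X n) where
  carrier := {y | ∃ x : ∀ i, X i, x a ∈ S ∧ x n = y ∧
    ∀ i, a ≤ i → i < n → (x i, x (i + 1)) ∈ C i}
  zero_mem' := ⟨0, S.zero_mem, rfl, fun i _ _ => (C i).zero_mem⟩
  add_mem' := by
    rintro _ _ ⟨x, hx, rfl, h⟩ ⟨x', hx', rfl, h'⟩
    exact ⟨x + x', S.add_mem hx hx', rfl, fun i h1 h2 => (C i).add_mem (h i h1 h2) (h' i h1 h2)⟩
  smul_mem' := by
    rintro c _ ⟨x, hx, rfl, h⟩
    exact ⟨c • x, S.smul_mem c hx, rfl, fun i h1 h2 => (C i).smul_mem c (h i h1 h2)⟩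

variable {C : ∀ i, Submodule k (X i × X (i + 1))}

theorem mem_reach {a n : ℤ} {S : Submodule k (X a)} {y : X n} :
    y ∈ reach C a S n ↔ ∃ x : ∀ i, X i, x a ∈ S ∧ x n = y ∧
      ∀ i, a ≤ i → i < n → (x i, x (i + 1)) ∈ C i := Iff.rfl

theorem reach_self (a : ℤ) (S : Submodule k (X a)) : reach C a S a = S := by
  ext y
  rw [mem_reach]
  constructor
  · rintro ⟨x, hx, rfl, -⟩
    exact hx
  · intro hy
    exact ⟨Function.update 0 a y, by simpa using hy, by simp, fun i h1 h2 => by omega⟩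

theorem reach_mono {a : ℤ} {S T : Submodule k (X a)} (h : S ≤ T) (n : ℤ) :
    reach C a S n ≤ reach C a T n := by
  rintro y ⟨x, hx, hy, hc⟩
  exact ⟨x, h hx, hy, hc⟩

theorem reach_trans {a b n : ℤ} (hab : a ≤ b) (hbn : b ≤ n) {S : Submodule k (X a)}
    {T : Submodule k (X b)} (h : T ≤ reach C a S b) : reach C b T n ≤ reach C a S n := by
  rintro y ⟨x, hx, hy, hc⟩
  obtain ⟨z, hz, hzb, hc'⟩ := h hx
  refine ⟨fun i => if i < b then z i else x i, ?_, ?_, fun i h1 h2 => ?_⟩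
  · dsimp only
    split_ifs with h3
    · exact hz
    · obtain rfl : a = b := by omega
      rwa [← hzb]
  · simpa [not_lt.2 hbn] using hy
  · dsimp only
    by_cases h3 : i < b
    · by_cases h4 : i + 1 < b
      · rw [if_pos h3, if_pos h4]
        exact hc' i h1 h3
      · obtain rfl : i + 1 = b := by omega
        rw [if_pos h3, if_neg h4, ← hzb]
        exact hc' i h1 h3
    · rw [if_neg h3, if_neg (by omega)]
      exact hc i (by omega) h2

theorem mem_reach_succ {a n : ℤ} (han : a ≤ n) {S : Submodule k (X a)} {y : X (n + 1)} :
    y ∈ reach C a S (n + 1) ↔ ∃ x ∈ reach C a S n, (x, y) ∈ C n := by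
  constructor
  · rintro ⟨x, hx, rfl, hc⟩
    exact ⟨x n, ⟨x, hx, rfl, fun i h1 h2 => hc i h1 (by omega)⟩, hc n han (by omega)⟩
  · rintro ⟨_, ⟨x, hx, rfl, hc⟩, h⟩
    refine ⟨Function.update x (n + 1) y, ?_, by simp, fun i h1 h2 => ?_⟩
    · rwa [Function.update_of_ne (by omega)]
    · rcases (show i < n ∨ i = n by omega) with h3 | rfl
      · rw [Function.update_of_ne (by omega), Function.update_of_ne (by omega)]
        exact hc i h1 h3
      · rwa [Function.update_of_ne (by omega), Function.update_self]

/-- The range of the transpose is the annihilator of the kernel. This is how functionals are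
extended backwards through a relation. -/
theorem exists_dual_comp_eq {V W : Type*} [AddCommGroup V] [Module k V] [AddCommGroup W]
    [Module k W] (f : V →ₗ[k] W) (g : Module.Dual k V) (h : LinearMap.ker f ≤ LinearMap.ker g) :
    ∃ t : Module.Dual k W, ∀ v, t (f v) = g v := by
  have : g ∈ LinearMap.range f.dualMap := by
    rw [LinearMap.range_dualMap_eq_dualAnnihilator_ker, Submodule.mem_dualAnnihilator]
    exact fun w hw => h hw
  obtain ⟨t, rfl⟩ := this
  exact ⟨t, fun v => rfl⟩

theorem exists_dual_of_notMem {V : Type*} [AddCommGroup V] [Module k V] (S : Submodule k V) {x : V}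
    (hx : x ∉ S) : ∃ f : Module.Dual k V, (∀ y ∈ S, f y = 0) ∧ f x = 1 := by
  obtain ⟨f, hf, hS⟩ := Submodule.exists_le_ker_of_notMem hx
  refine ⟨(f x)⁻¹ • f, fun y hy => ?_, ?_⟩
  · simp [LinearMap.mem_ker.1 (hS hy)]
  · simp [hf]

/-- A functional that kills everything reachable from `A` extends backwards to a compatible
sequence of functionals, the first of which kills `A`. -/
theorem exists_dual_chain {a n : ℤ} (han : a ≤ n) (A : Submodule k (X a)) :
    ∀ f : Module.Dual k (X n), (∀ y ∈ reach C a A n, f y = 0) →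
      ∃ t : ∀ i, Module.Dual k (X i), t n = f ∧ (∀ y ∈ A, t a y = 0) ∧
        ∀ i, a ≤ i → i < n → ∀ p ∈ C i, t i p.1 = t (i + 1) p.2 := by
  induction n, han using Int.leInduction with
  | base =>
    intro f hf
    rw [reach_self] at hf
    exact ⟨Function.update 0 a f, by simp, by simpa using hf, fun i h1 h2 => by omega⟩
  | succ n han ih =>
    intro f hf
    -- Two demands on `f'` are met at once: compatibility with `f` along `C n`, and vanishing on
    -- `reach C a A n`. They do not conflict: if `p.1 = -b` with `b` reachable, then `p.2` is
    -- reachable and `f` kills it.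
    obtain ⟨f', hf'⟩ := exists_dual_comp_eq
      ((LinearMap.fst k _ _ ∘ₗ (C n).subtype).coprod (reach C a A n).subtype)
      ((f ∘ₗ LinearMap.snd k _ _ ∘ₗ (C n).subtype).coprod 0) (by
        rintro ⟨⟨⟨y, y'⟩, hy⟩, ⟨b, hb⟩⟩ h
        simp only [LinearMap.mem_ker, LinearMap.coprod_apply, LinearMap.comp_apply,
          Submodule.subtype_apply, LinearMap.fst_apply, LinearMap.snd_apply,
          LinearMap.zero_apply, add_zero] at h ⊢
        refine hf y' ((mem_reach_succ han).2 ⟨y, ?_, hy⟩)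
        rw [eq_neg_of_add_eq_zero_left h]
        exact Submodule.neg_mem _ hb)
    obtain ⟨t, ht, htA, htc⟩ := ih f' fun y hy => by simpa using hf' (0, ⟨y, hy⟩)
    refine ⟨Function.update t (n + 1) f, by simp, ?_, fun i h1 h2 p hp => ?_⟩
    · rwa [Function.update_of_ne (by omega)]
    · rcases (show i < n ∨ i = n by omega) with h3 | rfl
      · rw [Function.update_of_ne (by omega), Function.update_of_ne (by omega)]
        exact htc i h1 h3 p hp
      · rw [Function.update_of_ne (by omega), Function.update_self, ht]
        simpa using hf' (⟨p, hp⟩, 0)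

/-- A chain `x` of elements together with a compatible chain `t` of functionals on the index
interval `[i + 1, n]`, satisfying the end conditions that make it split off. -/
structure IsString (C : ∀ i, Submodule k (X i × X (i + 1))) (i n : ℤ) (x : ∀ j, X j)
    (t : ∀ j, Module.Dual k (X j)) : Prop where
  le : i + 1 ≤ n
  chain : ∀ j, i + 1 ≤ j → j < n → (x j, x (j + 1)) ∈ C j
  dual_chain : ∀ j, i + 1 ≤ j → j < n → ∀ p ∈ C j, t j p.1 = t (j + 1) p.2
  pairing : t n (x n) = 1
  left : (0, x (i + 1)) ∈ C i ∨ ∀ p ∈ C i, t (i + 1) p.2 = 0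
  right : (x n, 0) ∈ C n ∨ ∀ p ∈ C n, t n p.1 = 0

/-- The quotient of the two reachable spaces can only collapse in passing from `n` to `n + 1` if
some class dies (it is related to zero) or fails to continue (it leaves the domain of the relation).
Either event is detected by a functional killing what `A` reaches, which `exists_dual_chain` pulls
back to `a`. -/
theorem reach_lt_or_exists_end {a : ℤ} {A B : Submodule k (X a)} (hAB : A < B) :
    (∀ n, a ≤ n → reach C a A n < reach C a B n) ∨
      ∃ (n : ℤ) (x : ∀ j, X j) (t : ∀ j, Module.Dual k (X j)), a ≤ n ∧ x a ∈ B ∧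
        (∀ y ∈ A, t a y = 0) ∧ (∀ j, a ≤ j → j < n → (x j, x (j + 1)) ∈ C j) ∧
        (∀ j, a ≤ j → j < n → ∀ p ∈ C j, t j p.1 = t (j + 1) p.2) ∧ t n (x n) = 1 ∧
        ((x n, 0) ∈ C n ∨ ∀ p ∈ C n, t n p.1 = 0) := by
  rw [or_iff_not_imp_right]
  intro hno n han
  induction n, han using Int.leInduction with
  | base => rwa [reach_self, reach_self]
  | succ n han ih =>
    refine lt_of_le_of_ne (reach_mono hAB.le _) fun heq => ?_
    obtain ⟨x, hxB, hxA⟩ := SetLike.exists_of_lt ih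
    have hker : ∀ y ∈ reach C a B n, (y, 0) ∈ C n → y ∈ reach C a A n := by
      intro y hyB hyC
      by_contra hyA
      obtain ⟨f, hf, hfy⟩ := exists_dual_of_notMem _ hyA
      obtain ⟨t, rfl, htA, htc⟩ := exists_dual_chain han A f hf
      obtain ⟨z, hz, rfl, hzc⟩ := hyB
      exact hno ⟨n, z, t, han, hz, htA, hzc, htc, hfy, Or.inl hyC⟩
    -- The functional must also kill the domain of `C n`: this is the second kind of right end.
    have hdom : x ∈ reach C a A n ⊔ (C n).map (LinearMap.fst k _ _) := by
      by_contra hx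
      obtain ⟨f, hf, hfx⟩ := exists_dual_of_notMem _ hx
      obtain ⟨t, rfl, htA, htc⟩ := exists_dual_chain han A f fun y hy =>
        hf y (Submodule.mem_sup_left hy)
      obtain ⟨z, hz, rfl, hzc⟩ := hxB
      exact hno ⟨n, z, t, han, hz, htA, hzc, htc, hfx, Or.inr fun p hp =>
        hf _ (Submodule.mem_sup_right ⟨p, hp, rfl⟩)⟩
    obtain ⟨b, hb, _, ⟨⟨d, y⟩, hdy, rfl⟩, rfl⟩ := Submodule.mem_sup.1 hdom
    have hdy' : (d, y) ∈ C n := hdy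
    have hdB : d ∈ reach C a B n := by
      have := Submodule.sub_mem _ hxB (reach_mono hAB.le _ hb)
      simpa using this
    have hdA : d ∉ reach C a A n := fun h => hxA (Submodule.add_mem _ hb h)
    have hy : y ∈ reach C a A (n + 1) := heq ▸ (mem_reach_succ han).2 ⟨d, hdB, hdy'⟩
    -- `d` and `b'` have the common successor `y`, so their difference is related to zero and `hker`
    -- applies.
    obtain ⟨b', hb', hby⟩ := (mem_reach_succ han).1 hy
    refine hdA ?_
    have h1 : d - b' ∈ reach C a A n := by
      refine hker _ (Submodule.sub_mem _ hdB (reach_mono hAB.le _ hb')) ?_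
      simpa using Submodule.sub_mem _ hdy' hby
    simpa using Submodule.add_mem _ h1 hb'

/-- A bar born at a kernel vector either ends, giving a string, or survives forever. Survivors make
the spaces reachable from zero shrink strictly when the starting index moves past a later defect,
which can happen at most `B` times. -/
theorem exists_isString_of_kernel [∀ i, Module.Finite k (X i)] (B : ℕ)
    (hB : ∀ i, Module.finrank k (X i) ≤ B)
    (hev : ∀ N : ℤ, ∃ i, N ≤ i ∧ ∃ x : X (i + 1), x ≠ 0 ∧ (0, x) ∈ C i) :
    ∃ i n x t, IsString C i n x t := by
  by_contra hno
  have key : ∀ i, (∃ x : X (i + 1), x ≠ 0 ∧ (0, x) ∈ C i) → ∀ n, i + 1 ≤ n →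
      reach C (i + 1) ⊥ n < reach C (i + 1) ((C i).comap (LinearMap.inr k _ _)) n := by
    rintro i ⟨x, hx0, hx⟩
    have hlt : (⊥ : Submodule k (X (i + 1))) < (C i).comap (LinearMap.inr k _ _) :=
      bot_lt_iff_ne_bot.2 fun h => hx0 <| by
        have : x ∈ (C i).comap (LinearMap.inr k _ _) := hx
        rwa [h] at this
    rcases reach_lt_or_exists_end (C := C) hlt with h | ⟨n, y, t, h1, h2, -, h4, h5, h6, h7⟩
    · exact h
    · exact absurd ⟨i, n, y, t, h1, h4, h5, h6, Or.inl h2, h7⟩ hno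
  have main : ∀ j : ℕ, ∃ i, ∀ n, i + 1 ≤ n →
      Module.finrank k (reach C (i + 1) ⊥ n) + j ≤ B := by
    intro j
    induction j with
    | zero => exact ⟨0, fun n _ => (Submodule.finrank_le _).trans (hB n)⟩
    | succ j ih =>
      obtain ⟨i, hi⟩ := ih
      obtain ⟨i', hii', hx⟩ := hev (i + 1)
      refine ⟨i', fun n hn => ?_⟩
      have h1 := Submodule.finrank_lt_finrank_of_lt (key i' hx n hn)
      -- A later kernel vector is itself reachable from zero: stay at `0` up to `i'`, then jump.
      have h2 : reach C (i' + 1) ((C i').comap (LinearMap.inr k _ _)) n ≤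
          reach C (i + 1) ⊥ n := by
        refine reach_trans (by omega) hn fun y hy => ?_
        exact (mem_reach_succ hii').2 ⟨0, Submodule.zero_mem _, hy⟩
      have h3 := Submodule.finrank_mono h2
      have h4 := hi n (by omega)
      omega
  obtain ⟨i, hi⟩ := main (B + 1)
  have := hi (i + 1) le_rfl
  omega

/-- Dual to the kernel case, with the image of `C i` inside the whole space as the strict inclusion.
What is reached from the image at later and later defects now grows strictly, since anything that
comes from `i + 1` must pass through the later image. -/
theorem exists_isString_of_cokernel [∀ i, Module.Finite k (X i)] (B : ℕ)
    (hB : ∀ i, Module.finrank k (X i) ≤ B)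
    (hev : ∀ N : ℤ, ∃ i, N ≤ i ∧ ∃ y : X (i + 1), ∀ x, (x, y) ∉ C i) :
    ∃ i n x t, IsString C i n x t := by
  by_contra hno
  have key : ∀ i, (∃ y : X (i + 1), ∀ x, (x, y) ∉ C i) → ∀ n, i + 1 ≤ n →
      reach C (i + 1) ((C i).map (LinearMap.snd k _ _)) n < reach C (i + 1) ⊤ n := by
    rintro i ⟨y, hy⟩
    have hlt : (C i).map (LinearMap.snd k _ _) < ⊤ := by
      refine lt_top_iff_ne_top.2 fun h => ?_
      have : y ∈ (C i).map (LinearMap.snd k _ _) := h ▸ Submodule.mem_top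
      obtain ⟨⟨x, _⟩, hx, rfl⟩ := this
      exact hy x hx
    rcases reach_lt_or_exists_end (C := C) hlt with h | ⟨n, y, t, h1, -, h3, h4, h5, h6, h7⟩
    · exact h
    · exact absurd ⟨i, n, y, t, h1, h4, h5, h6, Or.inr fun p hp => h3 _ ⟨p, hp, rfl⟩, h7⟩ hno
  have main : ∀ j : ℕ, ∃ i, (∃ y : X (i + 1), ∀ x, (x, y) ∉ C i) ∧ ∀ n, i + 1 ≤ n →
      j ≤ Module.finrank k (reach C (i + 1) ((C i).map (LinearMap.snd k _ _)) n) := by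
    intro j
    induction j with
    | zero =>
      obtain ⟨i, -, hi⟩ := hev 0
      exact ⟨i, hi, fun n _ => Nat.zero_le _⟩
    | succ j ih =>
      obtain ⟨i, hx, hi⟩ := ih
      obtain ⟨i', hii', hx'⟩ := hev (i + 1)
      refine ⟨i', hx', fun n hn => ?_⟩
      have h1 := Submodule.finrank_lt_finrank_of_lt (key i hx n (by omega))
      have h2 : reach C (i + 1) ⊤ n ≤
          reach C (i' + 1) ((C i').map (LinearMap.snd k _ _)) n := by
        rintro y ⟨x, -, hy, hc⟩
        exact ⟨x, ⟨_, hc i' hii' (by omega), rfl⟩, hy, fun l h3 h4 => hc l (by omega) h4⟩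
      have h3 := Submodule.finrank_mono h2
      have h4 := hi n (by omega)
      omega
  obtain ⟨i, -, hi⟩ := main (B + 1)
  have h1 := hi (i + 1) le_rfl
  have h2 := (Submodule.finrank_le
    (reach C (i + 1) ((C i).map (LinearMap.snd k _ _)) (i + 1))).trans (hB _)
  omega

/-- If every relation is a surjective partial map and the dimensions are periodic, then every
relation is the graph of a bijection. -/
theorem bijective_of_periodic [∀ i, Module.Finite k (X i)] {M : ℤ} (hM : 0 < M)
    (hper : ∀ i, Module.finrank k (X (i + M)) = Module.finrank k (X i))
    (hfun : ∀ i, ∀ y : X (i + 1), (0, y) ∈ C i → y = 0)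
    (hsurj : ∀ i, ∀ y : X (i + 1), ∃ x, (x, y) ∈ C i) (i : ℤ) :
    (∀ x, (x, 0) ∈ C i → x = 0) ∧ ∀ x, ∃ y, (x, y) ∈ C i := by
  have hinj : ∀ i, Function.Injective (LinearMap.fst k _ _ ∘ₗ (C i).subtype) := by
    intro i
    rw [injective_iff_map_eq_zero]
    rintro ⟨⟨x, y⟩, h⟩ hx
    obtain rfl : x = 0 := hx
    obtain rfl := hfun i y h
    rfl
  have hsu : ∀ i, Function.Surjective (LinearMap.snd k _ _ ∘ₗ (C i).subtype) := by
    intro i y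
    obtain ⟨x, hx⟩ := hsurj i y
    exact ⟨⟨(x, y), hx⟩, rfl⟩
  have h1 : ∀ i, Module.finrank k (C i) ≤ Module.finrank k (X i) := fun i =>
    LinearMap.finrank_le_finrank_of_injective (hinj i)
  have h2 : ∀ i, Module.finrank k (X (i + 1)) ≤ Module.finrank k (C i) := fun i =>
    LinearMap.finrank_le_finrank_of_surjective (hsu i)
  -- Injectivity of the first projection and surjectivity of the second sandwich the dimensions; an
  -- antitone periodic sequence is constant, so both projections are bijective.
  have hanti : Antitone fun i => Module.finrank k (X i) :=
    antitone_int_of_succ_le fun i => (h2 i).trans (h1 i)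
  have h3 : Module.finrank k (X i) ≤ Module.finrank k (X (i + 1)) := by
    rw [← hper i]
    exact hanti (by omega)
  have h4 := h1 i
  have h5 := h2 i
  constructor
  · intro x hx
    have hb : Function.Injective (LinearMap.snd k _ _ ∘ₗ (C i).subtype) :=
      (LinearMap.injective_iff_surjective_of_finrank_eq_finrank (by omega)).2 (hsu i)
    have := @hb ⟨(x, 0), hx⟩ 0 (by simp)
    exact congrArg (fun z : C i => z.1.1) this
  · intro x
    have hb : Function.Surjective (LinearMap.fst k _ _ ∘ₗ (C i).subtype) :=
      (LinearMap.injective_iff_surjective_of_finrank_eq_finrank (by omega)).1 (hinj i)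
    obtain ⟨⟨⟨_, y⟩, h⟩, rfl⟩ := hb x
    exact ⟨y, h⟩

end LinRel

end CircleSheaf

namespace CircleSheaf

universe u

noncomputable section

open Opposite

/-! ### Sections and germs of sheaves of vector spaces -/

variable {k : Type u} [Field k] {X : TopCat.{u}}

/-- The vector space of sections of `F` over `U`. -/
abbrev Sec (F : Sh k X) (U : Opens X) : ModuleCat.{u} k := F.presheaf.obj (op U)

/-- The stalk of `F` at `x`. -/
abbrev Stalk (F : Sh k X) (x : X) : ModuleCat.{u} k := F.presheaf.stalk x

/-- The restriction of sections. -/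
def res (F : Sh k X) {U V : Opens X} (h : U ≤ V) : Sec F V →ₗ[k] Sec F U :=
  (F.presheaf.map (homOfLE h).op).hom

/-- The germ of a section at a point. -/
def grm (F : Sh k X) {U : Opens X} {x : X} (h : x ∈ U) : Sec F U →ₗ[k] Stalk F x :=
  (F.presheaf.germ U x h).hom

/-- The action of a morphism of sheaves on sections. -/
def secMap {F G : Sh k X} (f : F ⟶ G) (U : Opens X) : Sec F U →ₗ[k] Sec G U :=
  (f.hom.app (op U)).hom

/-- The action of a morphism of sheaves on stalks. -/
def stalkMap {F G : Sh k X} (f : F ⟶ G) (x : X) : Stalk F x →ₗ[k] Stalk G x :=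
  ((TopCat.Presheaf.stalkFunctor (ModuleCat.{u} k) x).map f.hom).hom

section

variable (F : Sh k X)

@[simp] theorem res_self {U : Opens X} (h : U ≤ U) (s : Sec F U) : res F h s = s := by
  simp [res]

@[simp] theorem res_res {U V W : Opens X} (h : U ≤ V) (h' : V ≤ W) (s : Sec F W) :
    res F h (res F h' s) = res F (h.trans h') s := by
  have : F.presheaf.map (homOfLE (h.trans h')).op =
      F.presheaf.map (homOfLE h').op ≫ F.presheaf.map (homOfLE h).op := by
    rw [← F.presheaf.map_comp]; rfl
  simp [res, this]

@[simp] theorem grm_res {U V : Opens X} (h : U ≤ V) {x : X} (hx : x ∈ U) (s : Sec F V) :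
    grm F hx (res F h s) = grm F (h hx) s :=
  TopCat.Presheaf.germ_res_apply F.presheaf (homOfLE h) x hx s

theorem sec_ext {U : Opens X} {s t : Sec F U} (h : ∀ x (hx : x ∈ U), grm F hx s = grm F hx t) :
    s = t :=
  TopCat.Presheaf.section_ext F U s t h

theorem exists_grm_eq {x : X} (v : Stalk F x) {V : Opens X} (hV : x ∈ V) :
    ∃ (U : Opens X) (_ : U ≤ V) (hx : x ∈ U) (s : Sec F U), grm F hx s = v := by
  obtain ⟨U, h, hx, s, hs⟩ := TopCat.Presheaf.exists_le_germ_eq F.presheaf v hV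
  exact ⟨U, h, hx, s, hs⟩

theorem exists_res_eq {U V : Opens X} {x : X} (hU : x ∈ U) (hV : x ∈ V) (s : Sec F U) (t : Sec F V)
    (h : grm F hU s = grm F hV t) :
    ∃ (W : Opens X) (_ : x ∈ W) (h1 : W ≤ U) (h2 : W ≤ V), res F h1 s = res F h2 t := by
  obtain ⟨W, hx, i, j, hW⟩ := TopCat.Presheaf.germ_eq F.presheaf x hU hV s t h
  exact ⟨W, hx, i.le, j.le, hW⟩

/-- A family of germs that is locally given by sections is given by a section. -/
theorem exists_sec_of_grm {U : Opens X} (g : ∀ x, x ∈ U → Stalk F x)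
    (hg : ∀ x ∈ U, ∃ (V : Opens X) (_ : x ∈ V) (h : V ≤ U) (s : Sec F V),
      ∀ y (hy : y ∈ V), grm F hy s = g y (h hy)) :
    ∃ s : Sec F U, ∀ x (hx : x ∈ U), grm F hx s = g x hx := by
  choose V hxV hVU s hs using fun x : U => hg x.1 x.2
  obtain ⟨σ, hσ, -⟩ := F.existsUnique_gluing' V U (fun x => homOfLE (hVU x))
    (fun x hx => Opens.mem_iSup.2 ⟨⟨x, hx⟩, hxV _⟩) s (by
      intro x y
      refine TopCat.Presheaf.section_ext F _ _ _ fun z hz => ?_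
      exact ((grm_res F inf_le_left hz (s x)).trans (hs x z hz.1)).trans
        ((grm_res F inf_le_right hz (s y)).trans (hs y z hz.2)).symm)
  refine ⟨σ, fun x hx => ?_⟩
  have h1 : res F (hVU ⟨x, hx⟩) σ = s ⟨x, hx⟩ := hσ ⟨x, hx⟩
  rw [← grm_res F (hVU ⟨x, hx⟩) (hxV ⟨x, hx⟩), h1, hs]

end

section

variable {F G : Sh k X} (f : F ⟶ G)

@[simp] theorem secMap_res {U V : Opens X} (h : U ≤ V) (s : Sec F V) :
    secMap f U (res F h s) = res G h (secMap f V s) :=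
  congrArg (fun g => g.hom s) (f.hom.naturality (homOfLE h).op)

@[simp] theorem stalkMap_grm {U : Opens X} {x : X} (hx : x ∈ U) (s : Sec F U) :
    stalkMap f x (grm F hx s) = grm G hx (secMap f U s) :=
  TopCat.Presheaf.stalkFunctor_map_germ_apply U x hx f.hom s

@[simp] theorem secMap_id (U : Opens X) (s : Sec F U) : secMap (𝟙 F) U s = s := rfl

@[simp] theorem secMap_comp {H : Sh k X} (g : G ⟶ H) (U : Opens X) (s : Sec F U) :
    secMap (f ≫ g) U s = secMap g U (secMap f U s) := rfl

theorem isIso_of_stalkMap_bijective (h : ∀ x, Function.Bijective (stalkMap f x)) : IsIso f := by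
  have : ∀ x, IsIso ((TopCat.Presheaf.stalkFunctor (ModuleCat.{u} k) x).map f.hom) := fun x =>
    (ConcreteCategory.isIso_iff_bijective _).2 (h x)
  exact TopCat.Presheaf.isIso_of_stalkFunctor_map_iso f

/-- Construct a morphism of sheaves from compatible linear maps on sections. -/
def mkHom (φ : ∀ U, Sec F U →ₗ[k] Sec G U)
    (h : ∀ (U V : Opens X) (hUV : U ≤ V) (s : Sec F V), φ U (res F hUV s) = res G hUV (φ V s)) :
    F ⟶ G :=
  ObjectProperty.homMk
    { app := fun U => ModuleCat.ofHom (φ U.unop)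
      naturality := by
        intro U V i
        ext s
        exact h V.unop U.unop i.unop.le s }

end

/-! ### The constant sheaf as a sheaf of locally constant functions -/

section

variable (k X) (M : ModuleCat.{u} k)

theorem mem_extSections_univ {U : Opens X} (f : U → M) :
    f ∈ extSections k X Set.univ M U ↔ ∀ x : U, ∀ᶠ y in 𝓝 x, f y = f x := by
  refine (isExtSection_iff (V := M) (U := (U : Set X)) Set.univ f).trans ?_
  simp

/-- The morphism from the constant presheaf to the sheaf of locally constant functions. -/
def constToExt : (Functor.const (Opens X)ᵒᵖ).obj M ⟶ (extSheaf k X Set.univ M).obj where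
  app U := ModuleCat.ofHom
    { toFun := fun m => ⟨fun _ => m, (mem_extSections_univ k X M _).2 fun x => by simp⟩
      map_add' := fun _ _ => rfl
      map_smul' := fun _ _ => rfl }
  naturality _ _ _ := rfl

/-- The value of a section of an extension by zero at a point. -/
def extVal (Z : Set X) (V : Type u) [AddCommGroup V] [Module k V] {U : Opens X} (x : U) :
    Sec (extSheaf k X Z V) U →ₗ[k] V where
  toFun s := s.1 x
  map_add' _ _ := rfl
  map_smul' _ _ := rfl

/-- Both stalks are `M`: a locally constant function has the germ of its value at `x`. As
sheafification preserves stalks, this identifies the constant sheaf. -/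
theorem constToExt_stalk_bijective (x : X) : Function.Bijective
    ((TopCat.Presheaf.stalkFunctor (ModuleCat.{u} k) x).map (constToExt k X M)) := by
  set P : TopCat.Presheaf (ModuleCat.{u} k) X := (Functor.const (Opens X)ᵒᵖ).obj M
  constructor
  · intro a b hab
    obtain ⟨U, hU, s, rfl⟩ := TopCat.Presheaf.exists_germ_eq P a
    obtain ⟨V, hV, t, rfl⟩ := TopCat.Presheaf.exists_germ_eq P b
    rw [TopCat.Presheaf.stalkFunctor_map_germ_apply,
      TopCat.Presheaf.stalkFunctor_map_germ_apply] at hab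
    obtain ⟨W, hx, i, j, h⟩ := TopCat.Presheaf.germ_eq _ x hU hV _ _ hab
    have hst : s = t := congrArg (fun g => extVal k X Set.univ M (U := W) ⟨x, hx⟩ g) h
    refine TopCat.Presheaf.germ_ext P W hx i j ?_
    exact hst
  · intro a
    obtain ⟨U, hU, s, rfl⟩ := TopCat.Presheaf.exists_germ_eq (extSheaf k X Set.univ M).obj a
    have h1 := (mem_extSections_univ k X M s.1).1 s.2 ⟨x, hU⟩
    rw [nhds_subtype_eq_comap, Filter.eventually_comap] at h1
    obtain ⟨W, hW, hWo, hxW⟩ := eventually_nhds_iff.1 h1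
    let W' : Opens X := ⟨W, hWo⟩ ⊓ U
    refine ⟨P.germ U x hU (s.1 ⟨x, hU⟩ : M), ?_⟩
    rw [TopCat.Presheaf.stalkFunctor_map_germ_apply]
    refine TopCat.Presheaf.germ_ext _ W' ⟨hxW, hU⟩ (homOfLE inf_le_right) (homOfLE inf_le_right) ?_
    apply Subtype.ext
    funext y
    exact (hW y.1 y.2.1 ⟨y.1, y.2.2⟩ rfl).symm

/-- The constant sheaf is the sheaf of locally constant functions. -/
theorem nonempty_constantSheaf_iso_extSheaf :
    Nonempty ((constantSheaf (Opens.grothendieckTopology X) (ModuleCat.{u} k)).obj M ≅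
      extSheaf k X Set.univ M) := by
  let J := Opens.grothendieckTopology X
  let P : TopCat.Presheaf (ModuleCat.{u} k) X := (Functor.const (Opens X)ᵒᵖ).obj M
  let g : sheafify J P ⟶ (extSheaf k X Set.univ M).obj :=
    sheafifyLift J (constToExt k X M) (extSheaf k X Set.univ M).property
  let f : (show Sh k X from (constantSheaf J (ModuleCat.{u} k)).obj M) ⟶ extSheaf k X Set.univ M :=
    ObjectProperty.homMk g
  have hf : IsIso f := by
    refine isIso_of_stalkMap_bijective f fun x => ?_
    have h0 := TopCat.Presheaf.stalkFunctor_map_unit_toSheafify_isIso x (ModuleCat.{u} k) P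
    have h1 : (TopCat.Presheaf.stalkFunctor (ModuleCat.{u} k) x).map (toSheafify J P) ≫
        (TopCat.Presheaf.stalkFunctor (ModuleCat.{u} k) x).map g =
        (TopCat.Presheaf.stalkFunctor (ModuleCat.{u} k) x).map (constToExt k X M) := by
      rw [← Functor.map_comp, toSheafify_sheafifyLift]
    have h2 : IsIso ((TopCat.Presheaf.stalkFunctor (ModuleCat.{u} k) x).map
        (constToExt k X M)) :=
      (ConcreteCategory.isIso_iff_bijective _).2 (constToExt_stalk_bijective k X M x)
    rw [← h1] at h2
    have h3 := IsIso.of_isIso_comp_left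
      ((TopCat.Presheaf.stalkFunctor (ModuleCat.{u} k) x).map (toSheafify J P))
      ((TopCat.Presheaf.stalkFunctor (ModuleCat.{u} k) x).map g)
    exact (ConcreteCategory.isIso_iff_bijective _).1 h3
  exact ⟨@asIso _ _ _ _ f hf⟩

theorem isConstantOfFiniteRank_iff (F : Sh k X) : IsConstantOfFiniteRank F ↔
    ∃ M : ModuleCat.{u} k, Module.Finite k M ∧ Nonempty (F ≅ extSheaf k X Set.univ M) := by
  constructor
  · rintro ⟨M, hM, ⟨i⟩⟩
    obtain ⟨j⟩ := nonempty_constantSheaf_iso_extSheaf k X M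
    exact ⟨M, hM, ⟨i ≪≫ j⟩⟩
  · rintro ⟨M, hM, ⟨i⟩⟩
    obtain ⟨j⟩ := nonempty_constantSheaf_iso_extSheaf k X M
    exact ⟨M, hM, ⟨i ≪≫ j.symm⟩⟩

end

/-! ### Restriction of sheaves and constant sheaves -/

section

theorem isIso_of_secMap_bijective {F G : Sh k X} (f : F ⟶ G)
    (h : ∀ U, Function.Bijective (secMap f U)) : IsIso f := by
  have : ∀ U, IsIso (f.hom.app U) := fun U =>
    (ConcreteCategory.isIso_iff_bijective _).2 (h U.unop)
  have : IsIso f.hom := NatIso.isIso_of_isIso_app f.hom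
  have : IsIso ((TopCat.Sheaf.forget (ModuleCat.{u} k) X).map f) := this
  exact isIso_of_reflects_iso f (TopCat.Sheaf.forget (ModuleCat.{u} k) X)

theorem isOpenEmbedding_incl {s : Set X} (hs : IsOpen s) : IsOpenEmbedding (incl s) :=
  hs.isOpenEmbedding_subtypeVal

/-- The restriction of a sheaf to an open subset, computed naively. -/
abbrev openRestrict (F : Sh k X) {s : Set X} (hs : IsOpen s) : Sh k (TopCat.of s) :=
  ((isOpenEmbedding_incl hs).sheafPullback (ModuleCat.{u} k)).obj F

theorem isConstant_restrict_iff (F : Sh k X) {s : Set X} (hs : IsOpen s) :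
    IsConstantOfFiniteRank (restrict F s) ↔ ∃ M : ModuleCat.{u} k, Module.Finite k M ∧
      Nonempty (openRestrict F hs ≅ extSheaf k (TopCat.of s) Set.univ M) := by
  rw [isConstantOfFiniteRank_iff]
  have i : restrict F s ≅ openRestrict F hs :=
    ((isOpenEmbedding_incl hs).sheafPullbackIso (ModuleCat.{u} k)).app F
  constructor
  · rintro ⟨M, hM, ⟨j⟩⟩
    exact ⟨M, hM, ⟨i.symm ≪≫ j⟩⟩
  · rintro ⟨M, hM, ⟨j⟩⟩
    exact ⟨M, hM, ⟨i ≪≫ j⟩⟩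

/-- The open subset of `X` that is the image of an open subset of an open set `s`. -/
def imgOpen {s : Set X} (hs : IsOpen s) (V : Opens (TopCat.of s)) : Opens X :=
  (isOpenEmbedding_incl hs).functor.obj V

theorem mem_imgOpen {s : Set X} (hs : IsOpen s) (V : Opens (TopCat.of s)) (x : X) :
    x ∈ imgOpen hs V ↔ ∃ h : x ∈ s, (⟨x, h⟩ : s) ∈ V := by
  constructor
  · rintro ⟨y, hy, rfl⟩
    exact ⟨y.2, hy⟩
  · rintro ⟨h, hx⟩
    exact ⟨⟨x, h⟩, hx, rfl⟩

/-- The trace on `s` of an open subset of `X`. -/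
def preOpen (s : Set X) (W : Opens X) : Opens (TopCat.of s) := (Opens.map (incl s)).obj W

theorem imgOpen_preOpen {s : Set X} (hs : IsOpen s) {W : Opens X} (h : (W : Set X) ⊆ s) :
    imgOpen hs (preOpen s W) = W := by
  ext x
  simp only [SetLike.mem_coe, mem_imgOpen]
  exact ⟨fun h => h.2, fun hx => ⟨h hx, hx⟩⟩

/-- If `F` is constant on the open set `s`, then its sections over open subsets of `s` are the
locally constant functions with values in some finite-dimensional space. -/
theorem exists_values (F : Sh k X) {s : Set X} (hs : IsOpen s)
    (h : IsConstantOfFiniteRank (restrict F s)) :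
    ∃ (M : ModuleCat.{u} k) (φ : ∀ W : Opens X, (W : Set X) ⊆ s → (Sec F W →ₗ[k] (W → M))),
      (∀ W hW, Function.Injective (φ W hW)) ∧
      (∀ (W : Opens X) hW σ (x : W), ∀ᶠ y in 𝓝 x, φ W hW σ y = φ W hW σ x) ∧
      (∀ W hW (m : M), ∃ σ, φ W hW σ = fun _ => m) ∧
      (∀ (W W' : Opens X) hW hW' (hWW' : W ≤ W') σ (x : W),
        φ W hW (res F hWW' σ) x = φ W' hW' σ ⟨x.1, hWW' x.2⟩) := by
  obtain ⟨M, -, ⟨i⟩⟩ := (isConstant_restrict_iff F hs).1 h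
  let ψ : ∀ V : Opens (TopCat.of s), Sec F (imgOpen hs V) →ₗ[k]
      Sec (extSheaf k (TopCat.of s) Set.univ M) V := fun V => secMap i.hom V
  have hψ : ∀ V, Function.Bijective (ψ V) := fun V => by
    refine Function.bijective_iff_has_inverse.2 ⟨secMap i.inv V, fun σ => ?_, fun σ => ?_⟩
    · change secMap (i.hom ≫ i.inv) V σ = σ
      rw [i.hom_inv_id]; rfl
    · change secMap (i.inv ≫ i.hom) V σ = σ
      rw [i.inv_hom_id]; rfl
  refine ⟨M, fun W hW => LinearMap.pi fun x : W =>
    extVal k (TopCat.of s) Set.univ M (U := preOpen s W) ⟨⟨x.1, hW x.2⟩, x.2⟩ ∘ₗ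
      ψ (preOpen s W) ∘ₗ res F (imgOpen_preOpen hs hW).le, ?_, ?_, ?_, ?_⟩
  · intro W hW σ τ hστ
    have h1 : res F (imgOpen_preOpen hs hW).le σ = res F (imgOpen_preOpen hs hW).le τ := by
      apply (hψ _).1
      apply Subtype.ext
      funext x
      exact congrFun hστ ⟨x.1.1, x.2⟩
    have h2 := congrArg (res F (imgOpen_preOpen hs hW).ge) h1
    simpa using h2
  · intro W hW σ x
    have h1 := (mem_extSections_univ k (TopCat.of s) M _).1
      (ψ (preOpen s W) (res F (imgOpen_preOpen hs hW).le σ)).2 ⟨⟨x.1, hW x.2⟩, x.2⟩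
    have hc : Continuous fun y : W => (⟨⟨y.1, hW y.2⟩, y.2⟩ : preOpen s W) := by fun_prop
    exact hc.continuousAt.eventually h1
  · intro W hW m
    obtain ⟨τ, hτ⟩ := (hψ (preOpen s W)).2
      ⟨fun _ => m, (mem_extSections_univ k _ M _).2 fun x => by simp⟩
    refine ⟨res F (imgOpen_preOpen hs hW).ge τ, ?_⟩
    funext x
    have h1 : res F (imgOpen_preOpen hs hW).le (res F (imgOpen_preOpen hs hW).ge τ) = τ := by
      simp
    change extVal k (TopCat.of s) Set.univ M (U := preOpen s W) ⟨⟨x.1, hW x.2⟩, x.2⟩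
      (ψ (preOpen s W) (res F (imgOpen_preOpen hs hW).le
        (res F (imgOpen_preOpen hs hW).ge τ))) = m
    rw [h1, hτ]
    rfl
  · intro W W' hW hW' hWW' σ x
    have hle : preOpen s W ≤ preOpen s W' := fun y hy => hWW' hy
    have hle' : imgOpen hs (preOpen s W) ≤ imgOpen hs (preOpen s W') := by
      rw [imgOpen_preOpen hs hW, imgOpen_preOpen hs hW']
      exact hWW'
    have h1 : ψ (preOpen s W) (res F hle' (res F (imgOpen_preOpen hs hW').le σ)) =
        res _ hle (ψ (preOpen s W') (res F (imgOpen_preOpen hs hW').le σ)) :=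
      secMap_res i.hom hle _
    rw [res_res] at h1
    change extVal k (TopCat.of s) Set.univ M (U := preOpen s W) ⟨⟨x.1, hW x.2⟩, x.2⟩
      (ψ (preOpen s W) (res F (imgOpen_preOpen hs hW).le (res F hWW' σ))) = _
    rw [res_res, h1]
    rfl

/-- On a preconnected open set locally constant functions are constant, so a section is the same as
its value at `x`, and every germ has such a value. -/
theorem grm_bijective_of_isConstant (F : Sh k X) {s : Set X} (hs : IsOpen s)
    (h : IsConstantOfFiniteRank (restrict F s)) {U : Opens X} (hU : (U : Set X) ⊆ s)
    (hconn : IsPreconnected (U : Set X)) {x : X} (hx : x ∈ U) :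
    Function.Bijective (grm F hx : Sec F U →ₗ[k] Stalk F x) := by
  obtain ⟨M, φ, hinj, hloc, hconst, hres⟩ := exists_values F hs h
  have hc : PreconnectedSpace U := isPreconnected_iff_preconnectedSpace.1 hconn
  have hcst : ∀ (σ : Sec F U) (y : U), φ U hU σ y = φ U hU σ ⟨x, hx⟩ := fun σ y =>
    ((IsLocallyConstant.iff_eventually_eq _).2 (hloc U hU σ)).apply_eq_of_preconnectedSpace _ _
  constructor
  · rw [injective_iff_map_eq_zero]
    intro σ hσ
    obtain ⟨W, hxW, h1, h2, h3⟩ := exists_res_eq F hx hx σ 0 (by simpa using hσ)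
    refine hinj U hU ?_
    funext y
    rw [hcst, map_zero, Pi.zero_apply, ← hres W U (fun z hz => hU (h1 hz)) hU h1 σ ⟨x, hxW⟩, h3]
    simp
  · intro v
    obtain ⟨W, hWU, hxW, τ, rfl⟩ := exists_grm_eq F v hx
    have hW : (W : Set X) ⊆ s := fun z hz => hU (hWU hz)
    obtain ⟨σ, hσ⟩ := hconst U hU (φ W hW τ ⟨x, hxW⟩)
    refine ⟨σ, ?_⟩
    have h1 := hloc W hW τ ⟨x, hxW⟩
    rw [nhds_subtype_eq_comap, Filter.eventually_comap] at h1
    obtain ⟨N, hN, hNo, hxN⟩ := eventually_nhds_iff.1 h1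
    let W' : Opens X := ⟨N, hNo⟩ ⊓ W
    have hW'W : W' ≤ W := inf_le_right
    have hxW' : x ∈ W' := ⟨hxN, hxW⟩
    rw [← grm_res F (hW'W.trans hWU) hxW' σ, ← grm_res F hW'W hxW' τ]
    congr 1
    have hW' : (W' : Set X) ⊆ s := fun z hz => hW (hW'W hz)
    apply hinj W' hW'
    funext y
    rw [hres W' U hW' hU, hres W' W hW' hW, hσ]
    exact (hN y.1 y.2.1 ⟨y.1, y.2.2⟩ rfl).symm

/-- If all germ maps from `F(U)` are bijective, then `F` is constant on `U`. -/
theorem isConstant_restrict_of_grm_bijective (F : Sh k X) (U : Opens X)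
    (hfin : Module.Finite k (Sec F U))
    (hbij : ∀ x (hx : x ∈ U), Function.Bijective (grm F hx : Sec F U →ₗ[k] Stalk F x)) :
    IsConstantOfFiniteRank (restrict F (U : Set X)) := by
  refine (isConstant_restrict_iff F U.isOpen).2 ⟨Sec F U, hfin, ?_⟩
  let γ : ∀ x : (U : Set X), Sec F U ≃ₗ[k] Stalk F x.1 := fun x =>
    LinearEquiv.ofBijective (grm F x.2) (hbij x.1 x.2)
  have hγ : ∀ x σ, γ x σ = grm F x.2 σ := fun _ _ => rfl
  have hmem : ∀ {V : Opens (TopCat.of (U : Set X))} (x : V), x.1.1 ∈ imgOpen U.isOpen V :=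
    fun x => (mem_imgOpen _ _ _).2 ⟨x.1.2, x.2⟩
  -- A section becomes the function whose value at `x` is the unique section over `U` with the same
  -- germ at `x`. Sections with equal germs agree nearby, so this function is locally constant.
  let φ : ∀ V : Opens (TopCat.of (U : Set X)), Sec F (imgOpen U.isOpen V) →ₗ[k]
      extSections k (TopCat.of (U : Set X)) Set.univ (Sec F U) V := fun V =>
    { toFun := fun σ => ⟨fun x => (γ x.1).symm (grm F (hmem x) σ), by
        rw [mem_extSections_univ]
        intro x
        obtain ⟨W, hxW, h1, h2, h3⟩ := exists_res_eq F (hmem x) x.1.2 σ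
          ((γ x.1).symm (grm F (hmem x) σ)) (by rw [← hγ, LinearEquiv.apply_symm_apply])
        have : ∀ᶠ y : V in 𝓝 x, y.1.1 ∈ W :=
          (continuous_subtype_val.comp continuous_subtype_val).continuousAt.eventually
            (W.isOpen.mem_nhds hxW)
        filter_upwards [this] with y hy
        rw [LinearEquiv.symm_apply_eq, hγ, ← grm_res F h1 hy, ← grm_res F h2 hy, h3]⟩
      map_add' := fun σ τ => by
        apply Subtype.ext
        funext x
        simp
      map_smul' := fun c σ => by
        apply Subtype.ext
        funext x
        simp }
  let f : openRestrict F U.isOpen ⟶ extSheaf k (TopCat.of (U : Set X)) Set.univ (Sec F U) :=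
    mkHom φ (by
      intro V V' hVV' σ
      apply Subtype.ext
      funext x
      have hle : imgOpen U.isOpen V ≤ imgOpen U.isOpen V' := fun y hy => by
        obtain ⟨h1, h2⟩ := (mem_imgOpen _ _ _).1 hy
        exact (mem_imgOpen _ _ _).2 ⟨h1, hVV' h2⟩
      exact congrArg (γ x.1).symm (grm_res F hle (hmem x) σ))
  have hf : IsIso f := by
    refine isIso_of_secMap_bijective f fun V => ?_
    change Function.Bijective (φ V)
    constructor
    · intro σ τ hστ
      refine sec_ext F fun x hx => ?_
      obtain ⟨h1, h2⟩ := (mem_imgOpen _ _ _).1 hx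
      have := congrFun (congrArg Subtype.val hστ) ⟨⟨x, h1⟩, h2⟩
      exact (γ ⟨x, h1⟩).symm.injective this
    · intro g
      have hg := (mem_extSections_univ k (TopCat.of (U : Set X)) (Sec F U) _).1 g.2
      obtain ⟨σ, hσ⟩ := exists_sec_of_grm F (U := imgOpen U.isOpen V)
        (fun x hx => grm F (U := U) ((mem_imgOpen _ _ _).1 hx).1
          (g.1 ⟨⟨x, ((mem_imgOpen _ _ _).1 hx).1⟩, ((mem_imgOpen _ _ _).1 hx).2⟩)) (by
          intro x hx
          obtain ⟨h1, h2⟩ := (mem_imgOpen _ _ _).1 hx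
          obtain ⟨N, hN, hNo, hxN⟩ := eventually_nhds_iff.1 (hg ⟨⟨x, h1⟩, h2⟩)
          let N' : Opens (TopCat.of (U : Set X)) := ⟨Subtype.val '' N,
            V.isOpen.isOpenMap_subtype_val _ hNo⟩
          have hle : imgOpen U.isOpen N' ≤ imgOpen U.isOpen V := fun y hy => by
            obtain ⟨h3, ⟨z, hz, hzy⟩⟩ := (mem_imgOpen _ _ _).1 hy
            exact (mem_imgOpen _ _ _).2 ⟨h3, hzy ▸ z.2⟩
          have hleU : imgOpen U.isOpen N' ≤ U := fun y hy => ((mem_imgOpen _ _ _).1 hy).1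
          refine ⟨imgOpen U.isOpen N', (mem_imgOpen _ _ _).2 ⟨h1, ⟨⟨x, h1⟩, h2⟩, hxN, rfl⟩, hle,
            res F hleU (g.1 ⟨⟨x, h1⟩, h2⟩), fun y hy => ?_⟩
          obtain ⟨h3, ⟨z, hz, hzy⟩⟩ := (mem_imgOpen _ _ _).1 hy
          rw [grm_res]
          congr 1
          rw [← hN z hz]
          exact congrArg g.1 (Subtype.ext (Subtype.ext (congrArg Subtype.val hzy))))
      refine ⟨σ, ?_⟩
      apply Subtype.ext
      funext x
      change (γ x.1).symm (grm F (hmem x) σ) = g.1 x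
      rw [LinearEquiv.symm_apply_eq, hσ]
      rfl
  exact ⟨@asIso _ _ _ _ f hf⟩

theorem finite_stalk_extSheaf_univ (M : ModuleCat.{u} k) [Module.Finite k M] (x : X) :
    Module.Finite k (Stalk (extSheaf k X Set.univ M) x) := by
  let g : M →ₗ[k] Stalk (extSheaf k X Set.univ M) x :=
    grm (U := ⊤) (extSheaf k X Set.univ M) (Opens.mem_top x) ∘ₗ
      ((constToExt k X M).app (op ⊤)).hom
  refine Module.Finite.of_surjective g fun v => ?_
  obtain ⟨U, -, hxU, σ, rfl⟩ := exists_grm_eq _ v (Opens.mem_top x)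
  refine ⟨σ.1 ⟨x, hxU⟩, ?_⟩
  have h1 := (mem_extSections_univ k X M σ.1).1 σ.2 ⟨x, hxU⟩
  rw [nhds_subtype_eq_comap, Filter.eventually_comap] at h1
  obtain ⟨W, hW, hWo, hxW⟩ := eventually_nhds_iff.1 h1
  let W' : Opens X := ⟨W, hWo⟩ ⊓ U
  have hx' : x ∈ W' := ⟨hxW, hxU⟩
  have hle : W' ≤ U := inf_le_right
  refine (grm_res _ (le_top : W' ≤ ⊤) hx' _).symm.trans
    (Eq.trans ?_ (grm_res _ hle hx' _))
  congr 1
  apply Subtype.ext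
  funext y
  exact (hW y.1 y.2.1 ⟨y.1, y.2.2⟩ rfl).symm

/-- The stalks of a sheaf at the points of a subset on which it is constant of finite rank are
finite-dimensional. -/
theorem finite_stalk_of_isConstant_restrict (F : Sh k X) {Z : Set X}
    (h : IsConstantOfFiniteRank (restrict F Z)) (x : Z) : Module.Finite k (Stalk F x.1) := by
  obtain ⟨M, hM, ⟨i⟩⟩ := (isConstantOfFiniteRank_iff k _ _).1 h
  have h1 := finite_stalk_extSheaf_univ (X := TopCat.of Z) M x
  -- `Z` may be a single point, so the open-subset description is unavailable. The stalk is followed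
  -- through presheaf pullback and sheafification, neither of which changes it.
  let P := (TopCat.Presheaf.pullback (ModuleCat.{u} k) (incl Z)).obj F.presheaf
  let i1 : Stalk F x.1 ≅ P.stalk x :=
    TopCat.Presheaf.stalkPullbackIso (ModuleCat.{u} k) (incl Z) F.presheaf x
  have h2 := TopCat.Presheaf.stalkFunctor_map_unit_toSheafify_isIso x (ModuleCat.{u} k) P
  let i2 := asIso ((TopCat.Presheaf.stalkFunctor (ModuleCat.{u} k) x).map
    (toSheafify (Opens.grothendieckTopology (TopCat.of Z)) P))
  let i3 := (TopCat.Sheaf.forget (ModuleCat.{u} k) (TopCat.of Z) ⋙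
    TopCat.Presheaf.stalkFunctor (ModuleCat.{u} k) x).mapIso
      (((TopCat.Sheaf.pullbackIso (ModuleCat.{u} k) (incl Z)).app F).symm ≪≫ i)
  exact @Module.Finite.equiv _ _ _ _ _ _ _ _ h1 ((i1 ≪≫ i2 ≪≫ i3).toLinearEquiv.symm)

end

/-! ### Arcs on the circle -/

/-- The quotient map from the real line to the circle, as a function on `ℝ`. -/
def ex (c : ℝ) : circle.{u} := e (ULift.up c)

theorem ex_eq_iff {c c' : ℝ} : ex.{u} c = ex c' ↔ ∃ j : ℤ, c' = c + 2 * Real.pi * j := by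
  have h : ex.{u} c = ex c' ↔ (c : AddCircle (2 * Real.pi)) = c' := ULift.up_inj
  rw [h, eq_comm, ← sub_eq_zero, ← AddCircle.coe_sub, AddCircle.coe_eq_zero_iff]
  refine exists_congr fun j => ?_
  rw [zsmul_eq_mul]
  constructor <;> intro h <;> linarith

theorem ex_add (c : ℝ) (j : ℤ) : ex.{u} (c + 2 * Real.pi * j) = ex c := by
  rw [eq_comm, ex_eq_iff]
  exact ⟨j, rfl⟩

theorem continuous_ex : Continuous ex.{u} :=
  continuous_uliftUp.comp (AddCircle.continuous_mk' (2 * Real.pi))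

theorem isOpenMap_ex : IsOpenMap ex.{u} :=
  Homeomorph.ulift.symm.isOpenMap.comp QuotientAddGroup.isOpenMap_coe

theorem ex_surjective : Function.Surjective ex.{u} := by
  rintro ⟨x⟩
  obtain ⟨c, rfl⟩ := QuotientAddGroup.mk_surjective x
  exact ⟨c, rfl⟩

/-- The open arc that is the image of the open interval `(α, β)`. -/
def arc (α β : ℝ) : Opens circle.{u} := ⟨ex '' Set.Ioo α β, isOpenMap_ex _ isOpen_Ioo⟩

theorem mem_arc {α β : ℝ} {x : circle.{u}} : x ∈ arc α β ↔ ∃ c ∈ Set.Ioo α β, ex c = x := Iff.rfl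

theorem ex_mem_arc {α β c : ℝ} (h1 : α < c) (h2 : c < β) : ex.{u} c ∈ arc α β := ⟨c, ⟨h1, h2⟩, rfl⟩

theorem arc_mono {α β α' β' : ℝ} (h1 : α' ≤ α) (h2 : β ≤ β') : arc.{u} α β ≤ arc α' β' :=
  Set.image_mono (Set.Ioo_subset_Ioo h1 h2)

theorem isPreconnected_arc (α β : ℝ) : IsPreconnected (arc.{u} α β : Set circle.{u}) :=
  isPreconnected_Ioo.image _ continuous_ex.continuousOn

theorem arc_add (α β : ℝ) (j : ℤ) :
    arc.{u} (α + 2 * Real.pi * j) (β + 2 * Real.pi * j) = arc α β := by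
  ext x
  constructor
  · rintro ⟨c, ⟨h1, h2⟩, rfl⟩
    refine ⟨c - 2 * Real.pi * j, ⟨by linarith, by linarith⟩, ?_⟩
    rw [← ex_add _ j]; congr 1; ring
  · rintro ⟨c, ⟨h1, h2⟩, rfl⟩
    exact ⟨c + 2 * Real.pi * j, ⟨by linarith, by linarith⟩, ex_add _ _⟩

theorem eq_of_ex_eq {α c c' : ℝ} (hc : c ∈ Set.Ioo α (α + 2 * Real.pi))
    (hc' : c' ∈ Set.Ioo α (α + 2 * Real.pi)) (h : ex.{u} c = ex c') : c = c' := by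
  obtain ⟨j, rfl⟩ := ex_eq_iff.1 h
  have hp := Real.pi_pos
  obtain ⟨h1, h2⟩ := hc
  obtain ⟨h3, h4⟩ := hc'
  have h5 : (-1 : ℝ) < j := by
    by_contra! h5
    nlinarith
  have h6 : (j : ℝ) < 1 := by
    by_contra! h6
    nlinarith
  have h7 : (-1 : ℤ) < j := by exact_mod_cast h5
  have h8 : j < (1 : ℤ) := by exact_mod_cast h6
  obtain rfl : j = 0 := by omega
  simp

theorem ex_mem_arc_iff {γ α β c : ℝ} (h1 : γ ≤ α) (h2 : β ≤ γ + 2 * Real.pi)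
    (hc : c ∈ Set.Ioo γ (γ + 2 * Real.pi)) : ex.{u} c ∈ arc α β ↔ c ∈ Set.Ioo α β := by
  constructor
  · rintro ⟨c', hc', h⟩
    rwa [← eq_of_ex_eq ⟨h1.trans_lt hc'.1, hc'.2.trans_le h2⟩ hc h]
  · exact fun h => ⟨c, h, rfl⟩

/-- Both arcs must lift into one common interval of length `2π`; otherwise they could meet in two
components. -/
theorem arc_inf_arc {γ α β α' β' : ℝ} (h1 : γ ≤ α) (h2 : β ≤ γ + 2 * Real.pi) (h3 : γ ≤ α')
    (h4 : β' ≤ γ + 2 * Real.pi) : arc.{u} α β ⊓ arc α' β' = arc (max α α') (min β β') := by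
  ext x
  constructor
  · rintro ⟨⟨c, hc, rfl⟩, h⟩
    have h := (ex_mem_arc_iff h3 h4 ⟨h1.trans_lt hc.1, hc.2.trans_le h2⟩).1 h
    exact ⟨c, ⟨max_lt hc.1 h.1, lt_min hc.2 h.2⟩, rfl⟩
  · rintro ⟨c, hc, rfl⟩
    rw [Set.mem_Ioo, max_lt_iff, lt_min_iff] at hc
    exact ⟨ex_mem_arc hc.1.1 hc.2.1, ex_mem_arc hc.1.2 hc.2.2⟩

theorem eventually_ex_mem {U : Opens circle.{u}} {c : ℝ} (h : ex c ∈ U) : ∀ᶠ c' in 𝓝 c, ex c' ∈ U :=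
  continuous_ex.continuousAt.eventually (U.isOpen.mem_nhds h)

/-- Every property that holds near `c` holds on the lift of some neighbourhood of `ex c`. -/
theorem exists_arc_of_eventually {c : ℝ} {p : ℝ → Prop} (h : ∀ᶠ c' in 𝓝 c, p c') :
    ∃ ε > 0, ∀ c' ∈ Set.Ioo (c - ε) (c + ε), p c' := by
  obtain ⟨ε, hε, h⟩ := Metric.eventually_nhds_iff.1 h
  refine ⟨ε, hε, fun c' hc' => h ?_⟩
  rw [Real.dist_eq, abs_lt]
  exact ⟨by linarith [hc'.1], by linarith [hc'.2]⟩

/-! ### Periodic grids on the line -/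

/-- A periodic subdivision of the line. The points `q n` with `n` even are the special points, and
those with `n` odd lie between adjacent special points. -/
structure Grid where
  /-- the subdivision points -/
  q : ℤ → ℝ
  /-- the number of subdivision points in a period -/
  M : ℤ
  q_lt : ∀ n, q n < q (n + 1)
  M_pos : 0 < M
  M_even : Even M
  q_add_M : ∀ n, q (n + M) = q n + 2 * Real.pi
  q_gap : ∀ n, q (n + 2) ≤ q n + Real.pi

namespace Grid

variable (Q : Grid)

theorem strictMono : StrictMono Q.q := strictMono_int_of_lt_succ Q.q_lt

theorem q_add_mul_M (n j : ℤ) : Q.q (n + Q.M * j) = Q.q n + 2 * Real.pi * j := by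
  induction j with
  | zero => simp
  | succ j ih =>
    rw [show n + Q.M * ((j : ℤ) + 1) = n + Q.M * j + Q.M by ring, Q.q_add_M, ih]
    push_cast; ring
  | pred j ih =>
    have := Q.q_add_M (n + Q.M * (-(j : ℤ) - 1))
    rw [show n + Q.M * (-(j : ℤ) - 1) + Q.M = n + Q.M * -(j : ℤ) by ring, ih] at this
    push_cast at this ⊢
    linarith

/-- `c` lies in the cell with index `n`: the point `q n` for `n` even, the open interval between
`q (n - 1)` and `q (n + 1)` for `n` odd. -/
def Cell (n : ℤ) (c : ℝ) : Prop :=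
  Q.q (n - 1) < c ∧ c < Q.q (n + 1) ∧ (Even n → c = Q.q n)

theorem cell_q (n : ℤ) : Q.Cell n (Q.q n) :=
  ⟨Q.strictMono (by omega), Q.strictMono (by omega), fun _ => rfl⟩

theorem cell_of_odd {n : ℤ} (hn : ¬ Even n) {c : ℝ} (h1 : Q.q (n - 1) < c) (h2 : c < Q.q (n + 1)) :
    Q.Cell n c := ⟨h1, h2, fun h => absurd h hn⟩

/-- If the order were reversed the cells would have to be adjacent, and then one of them is a single
grid point bounding the other. This yields uniqueness of the cell index and its monotonicity. -/
theorem Cell.le {Q : Grid} {m n : ℤ} {c d : ℝ} (hc : Q.Cell m c) (hd : Q.Cell n d) (hcd : c ≤ d) :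
    m ≤ n := by
  by_contra! h
  obtain ⟨h1, h2, h3⟩ := hc
  obtain ⟨h4, h5, h6⟩ := hd
  have h7 : Q.q (m - 1) < Q.q (n + 1) := h1.trans_le (hcd.trans h5.le)
  have h8 := Q.strictMono.lt_iff_lt.1 h7
  obtain rfl : m = n + 1 := by omega
  rw [add_sub_cancel_right] at h1
  rcases Int.even_or_odd n with hn | hn
  · rw [h6 hn] at hcd
    linarith
  · rw [h3 hn.add_one] at hcd
    linarith

theorem exists_cell (c : ℝ) : ∃ n, Q.Cell n c := by
  have hp := Real.pi_pos
  obtain ⟨N, hN⟩ := Q.M_even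
  have hq : ∀ j : ℤ, Q.q (2 * (N * j)) = Q.q 0 + 2 * Real.pi * j := fun j => by
    rw [← Q.q_add_mul_M, hN]
    congr 1
    ring
  -- The last even grid point not exceeding `c`; `c` is that point or lies in the odd cell after it.
  obtain ⟨n, hn, hmax⟩ := Int.exists_greatest_of_bdd (P := fun n => Q.q (2 * n) ≤ c) (by
      obtain ⟨j, hj⟩ := exists_int_gt ((c - Q.q 0) / (2 * Real.pi))
      refine ⟨N * j, fun z hz => ?_⟩
      by_contra! h
      have h1 : Q.q (2 * (N * j)) ≤ Q.q (2 * z) := Q.strictMono.monotone (by omega)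
      rw [hq] at h1
      rw [div_lt_iff₀ (by positivity)] at hj
      linarith) (by
      obtain ⟨j, hj⟩ := exists_int_lt ((c - Q.q 0) / (2 * Real.pi))
      refine ⟨N * j, ?_⟩
      rw [lt_div_iff₀ (by positivity)] at hj
      rw [hq]
      linarith)
  have h2 : c < Q.q (2 * n + 2) := by
    by_contra! h
    have := hmax (n + 1) (by rwa [mul_add, mul_one])
    omega
  rcases hn.eq_or_lt with h | h
  · exact ⟨2 * n, h ▸ Q.cell_q _⟩
  · refine ⟨2 * n + 1, Q.cell_of_odd (by simp) ?_ ?_⟩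
    · rwa [add_sub_cancel_right]
    · rwa [add_assoc]

/-- The index of the cell that contains `c`. -/
def idx (c : ℝ) : ℤ := (Q.exists_cell c).choose

theorem cell_idx (c : ℝ) : Q.Cell (Q.idx c) c := (Q.exists_cell c).choose_spec

theorem idx_eq_iff {c : ℝ} {n : ℤ} : Q.idx c = n ↔ Q.Cell n c := by
  constructor
  · rintro rfl
    exact Q.cell_idx c
  · intro h
    exact le_antisymm ((Q.cell_idx c).le h le_rfl) (h.le (Q.cell_idx c) le_rfl)

theorem idx_mono : Monotone Q.idx := fun c d h => (Q.cell_idx c).le (Q.cell_idx d) h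

theorem idx_q (n : ℤ) : Q.idx (Q.q n) = n := Q.idx_eq_iff.2 (Q.cell_q n)

theorem idx_add (c : ℝ) (j : ℤ) : Q.idx (c + 2 * Real.pi * j) = Q.idx c + Q.M * j := by
  rw [idx_eq_iff]
  obtain ⟨h1, h2, h3⟩ := Q.cell_idx c
  refine ⟨?_, ?_, fun h => ?_⟩
  · rw [show Q.idx c + Q.M * j - 1 = Q.idx c - 1 + Q.M * j by ring, Q.q_add_mul_M]
    linarith
  · rw [show Q.idx c + Q.M * j + 1 = Q.idx c + 1 + Q.M * j by ring, Q.q_add_mul_M]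
    linarith
  · rw [Q.q_add_mul_M, ← h3]
    have h4 : Even (Q.M * j) := Q.M_even.mul_right j
    exact (Int.even_add.1 h).2 h4

/-- Two consecutive stars together span at most one turn, so that their intersection is a single
arc. -/
theorem q_add_three_le (n : ℤ) : Q.q (n + 3) ≤ Q.q n + 2 * Real.pi := by
  have h1 := Q.q_gap n
  have h2 := Q.q_gap (n + 2)
  have h3 := Q.q_lt (n + 3)
  rw [show n + 3 + 1 = n + 2 + 2 by ring] at h3
  linarith

end Grid

/-- A strictly monotone bi-infinite enumeration of a set of reals that is invariant under
translation by `2π`, has finitely many points in bounded intervals, and contains `πℤ`. -/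
theorem exists_enumeration (D : Set ℝ) (hfin : ∀ a b, (D ∩ Set.Icc a b).Finite)
    (hadd : ∀ c, c ∈ D ↔ c + 2 * Real.pi ∈ D) (hpi : ∀ j : ℤ, Real.pi * j ∈ D) :
    ∃ (θ : ℤ → ℝ) (N : ℤ), StrictMono θ ∧ 0 < N ∧ (∀ i, θ (i + N) = θ i + 2 * Real.pi) ∧
      (∀ i, θ (i + 1) ≤ θ i + Real.pi) ∧ Set.range θ = D := by
  have hp := Real.pi_pos
  let _ : LocallyFiniteOrder D := LocallyFiniteOrder.ofFiniteIcc fun a b => by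
    refine Set.Finite.of_finite_image (f := Subtype.val) ((hfin a b).subset ?_)
      Subtype.val_injective.injOn
    rintro _ ⟨c, hc, rfl⟩
    exact ⟨c.2, hc⟩
  have hgt : ∀ c : ℝ, ∃ j : ℤ, c < Real.pi * j ∧ Real.pi * j ≤ c + Real.pi := fun c => by
    refine ⟨⌊c / Real.pi⌋ + 1, ?_, ?_⟩
    · have := Int.lt_floor_add_one (c / Real.pi)
      rw [div_lt_iff₀ hp] at this
      push_cast
      linarith
    · have := Int.floor_le (c / Real.pi)
      rw [le_div_iff₀ hp] at this
      push_cast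
      linarith
  have _ : Nonempty D := ⟨⟨_, hpi 0⟩⟩
  have _ : NoMaxOrder D := ⟨fun a => by
    obtain ⟨j, hj, -⟩ := hgt a
    exact ⟨⟨_, hpi j⟩, hj⟩⟩
  have _ : NoMinOrder D := ⟨fun a => by
    obtain ⟨j, -, hj⟩ := hgt (a - 2 * Real.pi)
    exact ⟨⟨_, hpi j⟩, show Real.pi * j < (a : ℝ) by linarith⟩⟩
  let _ : SuccOrder D := LinearLocallyFiniteOrder.succOrder D
  let _ : PredOrder D := LinearLocallyFiniteOrder.predOrder D
  let E : D ≃o ℤ := orderIsoIntOfLinearSuccPredArch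
  let θ : ℤ → ℝ := fun i => (E.symm i : D)
  have hθ : StrictMono θ := fun i j h => E.symm.strictMono h
  have hrange : ∀ c ∈ D, ∃ i, θ i = c := fun c hc => ⟨E ⟨c, hc⟩, by simp [θ]⟩
  have hmem : ∀ i, θ i ∈ D := fun i => (E.symm i).2
  -- Translation by `2π` acts on indices as an order automorphism of `ℤ`, hence as the shift by `s
  -- 0`, which is the period.
  choose s hs using fun i => hrange _ ((hadd _).1 (hmem i))
  have hsm : StrictMono s := fun i j hij => by
    rw [← hθ.lt_iff_lt, hs, hs]
    linarith [hθ hij]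
  have hsurj : ∀ j, ∃ i, s i = j := fun j => by
    obtain ⟨i, hi⟩ := hrange (θ j - 2 * Real.pi) ((hadd _).2 (by simpa using hmem j))
    refine ⟨i, hθ.injective ?_⟩
    rw [hs, hi]
    ring
  have hsucc : ∀ i, s (i + 1) = s i + 1 := fun i => by
    have h1 := hsm (show i < i + 1 by omega)
    by_contra h2
    obtain ⟨l, hl⟩ := hsurj (s i + 1)
    have h3 : i < l := hsm.lt_iff_lt.1 (by omega)
    have h4 : l < i + 1 := hsm.lt_iff_lt.1 (by omega)
    omega
  have hs0 : ∀ i, s i = i + s 0 := fun i => by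
    induction i with
    | zero => simp
    | succ i ih => rw [hsucc, ih]; ring
    | pred i ih =>
      have := hsucc (-(i : ℤ) - 1)
      rw [sub_add_cancel, ih] at this
      omega
  refine ⟨θ, s 0, hθ, ?_, fun i => ?_, fun i => ?_, ?_⟩
  · rw [← hθ.lt_iff_lt, hs]
    linarith
  · rw [← hs0, hs]
  · obtain ⟨j, h1, h2⟩ := hgt (θ i)
    obtain ⟨l, hl⟩ := hrange _ (hpi j)
    rw [← hl, hθ.lt_iff_lt] at h1
    exact (hθ.monotone (show i + 1 ≤ l by omega)).trans (hl ▸ h2)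
  · ext c
    exact ⟨fun ⟨i, hi⟩ => hi ▸ hmem i, hrange c⟩

theorem finite_ex_preimage_inter_Icc {P : Set circle.{u}} (hP : P.Finite) (a b : ℝ) :
    (ex ⁻¹' P ∩ Set.Icc a b).Finite := by
  have hp := Real.pi_pos
  rw [← Set.biUnion_preimage_singleton, Set.iUnion₂_inter]
  refine hP.biUnion fun x _ => ?_
  obtain ⟨c, rfl⟩ := ex_surjective x
  refine ((Set.finite_Icc ⌈(a - c) / (2 * Real.pi)⌉ ⌊(b - c) / (2 * Real.pi)⌋).image
    fun j : ℤ => c + 2 * Real.pi * j).subset ?_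
  rintro d ⟨hd, h1, h2⟩
  obtain ⟨j, rfl⟩ := ex_eq_iff.1 (Eq.symm hd)
  refine ⟨j, ⟨?_, ?_⟩, rfl⟩
  · rw [Int.ceil_le, div_le_iff₀ (by positivity)]
    linarith
  · rw [Int.le_floor, le_div_iff₀ (by positivity)]
    linarith

/-- Every finite set of points of the circle is contained in the set of special points of a grid. -/
theorem exists_grid {P : Set circle.{u}} (hP : P.Finite) :
    ∃ Q : Grid, ∀ c, ex c ∈ P → Even (Q.idx c) := by
  have hp := Real.pi_pos
  obtain ⟨θ, N, hθ, hN, hper, hgap, hr⟩ :=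
    -- Adjoining the images of `0` and `π` guarantees that there are special points and that their
    -- gaps are at most `π`.
    exists_enumeration (ex.{u} ⁻¹' (P ∪ {ex 0, ex Real.pi}))
    (finite_ex_preimage_inter_Icc (hP.union (Set.toFinite _)))
    (fun c => by
      have := ex_add.{u} c 1
      simp only [Int.cast_one, mul_one] at this
      rw [Set.mem_preimage, Set.mem_preimage, this])
    (fun j => by
      right
      obtain ⟨l, rfl | rfl⟩ := Int.even_or_odd' j
      · left
        rw [← ex_add 0 l]
        congr 1
        push_cast
        ring
      · right
        rw [Set.mem_singleton_iff, ← ex_add Real.pi l]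
        congr 1
        push_cast
        ring)
  have hq0 : ∀ i : ℤ, (2 * i) / 2 = i ∧ (2 * i + 1) / 2 = i ∧ (2 * i + 1 + 1) / 2 = i + 1 ∧
      (2 * i + 1 + 1 + 1) / 2 = i + 1 := fun i => by omega
  let Q : Grid :=
    -- With floor division this is `θ i` at `2 * i` and the midpoint of `θ i` and `θ (i + 1)` at `2
    -- * i + 1`.
    { q := fun n => (θ (n / 2) + θ ((n + 1) / 2)) / 2
      M := 2 * N
      q_lt := fun n => by
        obtain ⟨i, rfl | rfl⟩ := Int.even_or_odd' n
        · obtain ⟨h1, h2, h3, -⟩ := hq0 i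
          rw [h1, h2, h3]
          linarith [hθ (show i < i + 1 by omega)]
        · obtain ⟨h1, h2, h3, h4⟩ := hq0 i
          rw [h2, h3, h4]
          linarith [hθ (show i < i + 1 by omega)]
      M_pos := by omega
      M_even := even_two_mul N
      q_add_M := fun n => by
        rw [show (n + 2 * N) / 2 = n / 2 + N by omega,
          show (n + 2 * N + 1) / 2 = (n + 1) / 2 + N by omega, hper, hper]
        ring
      q_gap := fun n => by
        rw [show (n + 2) / 2 = n / 2 + 1 by omega,
          show (n + 2 + 1) / 2 = (n + 1) / 2 + 1 by omega]
        linarith [hgap (n / 2), hgap ((n + 1) / 2)] }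
  refine ⟨Q, fun c hc => ?_⟩
  obtain ⟨i, rfl⟩ : c ∈ Set.range θ := by
    rw [hr]
    exact Or.inl hc
  have : θ i = Q.q (2 * i) := by
    obtain ⟨h1, h2, -⟩ := hq0 i
    change _ = (θ (2 * i / 2) + θ ((2 * i + 1) / 2)) / 2
    rw [h1, h2]
    ring
  rw [this, Q.idx_q]
  exact even_two_mul i

/-! ### Sheaves adapted to a grid -/

/-- The open arc around the grid point with index `n`. -/
def Grid.star (Q : Grid) (n : ℤ) : Opens circle.{u} := arc (Q.q (n - 1)) (Q.q (n + 1))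

/-- A sheaf on the circle is adapted to a grid if its sections over small arcs are determined by
their germs at the special point (or at any point, if there is no special point). -/
structure Adapted (Q : Grid) (F : Sh k circle.{u}) : Prop where
  fin : ∀ n, Module.Finite k (Sec F (Q.star n))
  bij : ∀ {n c α β}, Q.Cell n c → Q.q (n - 1) ≤ α → β ≤ Q.q (n + 1) → ∀ (h1 : α < c) (h2 : c < β),
    Function.Bijective (grm F (ex_mem_arc h1 h2))

/-! ### Functoriality of stalks and passage to retracts -/

section Stalk

variable {F G H : Sh k X}

theorem stalkMap_comp (f : F ⟶ G) (g : G ⟶ H) (x : X) (v : Stalk F x) :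
    stalkMap (f ≫ g) x v = stalkMap g x (stalkMap f x v) := by
  obtain ⟨U, -, hx, s, rfl⟩ := exists_grm_eq F v (Opens.mem_top x)
  simp

theorem stalkMap_id (x : X) (v : Stalk F x) : stalkMap (𝟙 F) x v = v := by
  obtain ⟨U, -, hx, s, rfl⟩ := exists_grm_eq F v (Opens.mem_top x)
  simp

end Stalk

theorem secMap_injective_of_retract {X : TopCat.{u}} {F G : Sh k X} {i : G ⟶ F} {r : F ⟶ G}
    (hir : i ≫ r = 𝟙 G) (U : Opens X) : Function.Injective (secMap i U) := fun s t h => by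
  rw [← secMap_id (F := G) U s, ← secMap_id (F := G) U t, ← hir, secMap_comp, secMap_comp, h]

/-- A retract of a bijection is a bijection, applied to the germ maps. This keeps the grid fixed
throughout the induction. -/
theorem Adapted.of_retract {Q : Grid} {F G : Sh k circle.{u}} (hF : Adapted Q F) {i : G ⟶ F}
    {r : F ⟶ G} (hir : i ≫ r = 𝟙 G) : Adapted Q G where
  fin n := by
    have := hF.fin n
    exact Module.Finite.of_injective _ (secMap_injective_of_retract hir (Q.star n))
  bij {n c α β} hc h1 h2 h3 h4 := by
    have hb := hF.bij hc h1 h2 h3 h4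
    constructor
    · intro s t hst
      refine secMap_injective_of_retract hir _ (hb.1 ?_)
      rw [← stalkMap_grm, ← stalkMap_grm, hst]
    · intro v
      obtain ⟨τ, hτ⟩ := hb.2 (stalkMap i _ v)
      refine ⟨secMap r _ τ, ?_⟩
      rw [← stalkMap_grm, hτ, ← stalkMap_comp, hir, stalkMap_id]

/-! ### Constructible sheaves are adapted to a grid -/

instance compactSpace_circle : CompactSpace circle.{u} := by
  have : Fact (0 < 2 * Real.pi) := ⟨by positivity⟩
  exact Homeomorph.ulift.symm.compactSpace

/-- Every stratum meeting the arc is open, so the strata cut the connected arc into disjoint open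
pieces, of which only one can be nonempty. -/
theorem exists_stratum_of_arc {S : Set (Set circle.{u})} (hS : IsStratification S) {α β c : ℝ}
    (h1 : α < c) (h2 : c < β) (h : ∀ d ∈ Set.Ioo α β, {ex.{u} d} ∉ S) :
    ∃ s ∈ S, IsOpen s ∧ (arc.{u} α β : Set circle.{u}) ⊆ s := by
  have hop : ∀ d ∈ Set.Ioo α β, ∀ s ∈ S, ex d ∈ s → IsOpen s := by
    intro d hd s hs hds
    rcases hS.point_or_open s hs with ⟨x, rfl⟩ | ho
    · rw [Set.mem_singleton_iff] at hds
      exact absurd (hds ▸ hs) (h d hd)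
    · exact ho
  obtain ⟨s, ⟨hs, hcs⟩, -⟩ := hS.isPartition.2 (ex c)
  have hso := hop c ⟨h1, h2⟩ s hs hcs
  refine ⟨s, hs, hso, ?_⟩
  refine (isPreconnected_arc α β).subset_left_of_subset_union (u := s)
    (v := ⋃₀ {t ∈ S | t ≠ s ∧ IsOpen t}) hso (isOpen_sUnion fun t ht => ht.2.2) ?_ ?_
    ⟨ex c, ex_mem_arc h1 h2, hcs⟩
  · rw [Set.disjoint_sUnion_right]
    intro t ht
    exact hS.isPartition.pairwiseDisjoint hs ht.1 ht.2.1.symm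
  · rintro _ ⟨d, hd, rfl⟩
    obtain ⟨t, ⟨ht, hdt⟩, -⟩ := hS.isPartition.2 (ex d)
    by_cases hts : t = s
    · exact Or.inl (hts ▸ hdt)
    · exact Or.inr ⟨t, ⟨ht, hts, hop d hd t ht hdt⟩, hdt⟩

/-- If germs are bijective on both sides of `c`, they are bijective at `c`. -/
theorem grm_bijective_of_sides (F : Sh k circle.{u}) {α β c : ℝ} (h1 : α < c) (h2 : c < β)
    (hlen : β ≤ α + 2 * Real.pi)
    (hb : ∀ {α' β' d : ℝ}, α ≤ α' → β' ≤ β → (β' ≤ c ∨ c ≤ α') → ∀ (h : α' < d) (h' : d < β'),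
      Function.Bijective (grm F (ex_mem_arc h h'))) :
    Function.Bijective (grm F (ex_mem_arc h1 h2)) := by
  have hL : arc.{u} α c ≤ arc α β := arc_mono le_rfl h2.le
  have hR : arc.{u} c β ≤ arc α β := arc_mono h1.le le_rfl
  constructor
  · rw [injective_iff_map_eq_zero]
    intro σ hσ
    obtain ⟨W, hcW, h3, h4, h5⟩ := exists_res_eq F _ (ex_mem_arc h1 h2) σ 0 (by simpa using hσ)
    obtain ⟨ε, hε, hW⟩ := exists_arc_of_eventually (eventually_ex_mem hcW)
    -- `σ` vanishes near `c`, in particular at some point on each side; injectivity there spreads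
    -- the vanishing over each half.
    have hz : ∀ {d} (hd : ex d ∈ arc α β), ex d ∈ W → grm F hd σ = 0 := by
      intro d hd hdW
      rw [← grm_res F h3 hdW, h5]
      simp
    refine sec_ext F ?_
    rintro _ ⟨d, ⟨hd1, hd2⟩, rfl⟩
    rw [map_zero]
    rcases lt_trichotomy d c with hdc | rfl | hdc
    · have h6 : max α (c - ε) < c := max_lt h1 (by linarith)
      obtain ⟨d', hd', hd'c⟩ := exists_between h6
      rw [max_lt_iff] at hd'
      have h7 : res F hL σ = 0 := by
        apply (hb le_rfl h2.le (Or.inl le_rfl) hd'.1 hd'c).1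
        rw [grm_res, map_zero]
        exact hz _ (hW d' ⟨hd'.2, by linarith⟩)
      rw [← grm_res F hL (ex_mem_arc hd1 hdc), h7, map_zero]
    · exact hσ
    · have h6 : c < min β (c + ε) := lt_min h2 (by linarith)
      obtain ⟨d', hd'c, hd'⟩ := exists_between h6
      rw [lt_min_iff] at hd'
      have h7 : res F hR σ = 0 := by
        apply (hb h1.le le_rfl (Or.inr le_rfl) hd'c hd'.1).1
        rw [grm_res, map_zero]
        exact hz _ (hW d' ⟨by linarith, hd'.2⟩)
      rw [← grm_res F hR (ex_mem_arc hdc hd2), h7, map_zero]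
  · intro v
    obtain ⟨W, hWle, hcW, τ, rfl⟩ := exists_grm_eq F v (ex_mem_arc h1 h2)
    obtain ⟨ε, hε, hW⟩ := exists_arc_of_eventually ((eventually_ex_mem hcW).and
      ((eventually_gt_nhds h1).and (eventually_lt_nhds h2)))
    have hα : α ≤ c - ε := by
      by_contra! h
      exact lt_irrefl _ (hW α ⟨h, by linarith⟩).2.1
    have hβ : c + ε ≤ β := by
      by_contra! h
      exact lt_irrefl _ (hW β ⟨by linarith, h⟩).2.2
    have hWε : arc.{u} (c - ε) (c + ε) ≤ W := by
      rintro _ ⟨d, hd, rfl⟩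
      exact (hW d hd).1
    have hsub1 : arc.{u} (c - ε) c ≤ W := (arc_mono le_rfl (by linarith)).trans hWε
    have hsub2 : arc.{u} c (c + ε) ≤ W := (arc_mono (by linarith) le_rfl).trans hWε
    -- The germ of `τ` at `c - ε / 2` extends over the whole left half; injectivity on the smaller
    -- arc forces agreement with `τ` there. The right half is symmetric.
    obtain ⟨σL, hσL⟩ : ∃ σL : Sec F (arc α c), res F (arc_mono hα le_rfl) σL = res F hsub1 τ := by
      obtain ⟨σL, h⟩ := (hb le_rfl h2.le (Or.inl le_rfl) (show α < c - ε / 2 by linarith)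
        (show c - ε / 2 < c by linarith)).2
        (grm F (hWε (ex_mem_arc (by linarith) (by linarith))) τ)
      refine ⟨σL, (hb hα h2.le (Or.inl le_rfl) (show c - ε < c - ε / 2 by linarith)
        (show c - ε / 2 < c by linarith)).1 ?_⟩
      rw [grm_res, grm_res, h]
    obtain ⟨σR, hσR⟩ : ∃ σR : Sec F (arc c β), res F (arc_mono le_rfl hβ) σR = res F hsub2 τ := by
      obtain ⟨σR, h⟩ := (hb h1.le le_rfl (Or.inr le_rfl) (show c < c + ε / 2 by linarith)
        (show c + ε / 2 < β by linarith)).2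
        (grm F (hWε (ex_mem_arc (by linarith) (by linarith))) τ)
      refine ⟨σR, (hb h1.le hβ (Or.inr le_rfl) (show c < c + ε / 2 by linarith)
        (show c + ε / 2 < c + ε by linarith)).1 ?_⟩
      rw [grm_res, grm_res, h]
    have hmL : ∀ {d}, d ∈ Set.Ioo α β → (ex.{u} d ∈ arc α c ↔ d < c) := fun {d} hd => by
      rw [ex_mem_arc_iff le_rfl (by linarith) ⟨hd.1, by linarith [hd.2]⟩]
      exact ⟨fun h => h.2, fun h => ⟨hd.1, h⟩⟩
    have hmR : ∀ {d}, d ∈ Set.Ioo α β → (ex.{u} d ∈ arc c β ↔ c < d) := fun {d} hd => by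
      rw [ex_mem_arc_iff h1.le (by linarith) ⟨hd.1, by linarith [hd.2]⟩]
      exact ⟨fun h => h.1, fun h => ⟨h, hd.2⟩⟩
    classical
    -- Within the arc, `τ` supplies only the germ at `ex c`; the default `0` is never used.
    let g : ∀ x, x ∈ arc α β → Stalk F x := fun x _ =>
      if h : x ∈ arc α c then grm F h σL else if h : x ∈ arc c β then grm F h σR else
        if h : x ∈ W then grm F h τ else 0
    have hgL : ∀ {x} (hx : x ∈ arc α β) (h : x ∈ arc α c), g x hx = grm F h σL := fun hx h =>
      dif_pos h
    have hgR : ∀ {x} (hx : x ∈ arc α β) (h : x ∈ arc c β), g x hx = grm F h σR := by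
      rintro _ ⟨d, hd, rfl⟩ h
      have h' : ex d ∉ arc α c := fun h' => lt_asymm ((hmL hd).1 h') ((hmR hd).1 h)
      exact (dif_neg h').trans (dif_pos h)
    have hgc : g (ex c) (ex_mem_arc h1 h2) = grm F hcW τ := by
      have h3 : ex c ∉ arc α c := fun h' => lt_irrefl _ ((hmL ⟨h1, h2⟩).1 h')
      have h4 : ex c ∉ arc c β := fun h' => lt_irrefl _ ((hmR ⟨h1, h2⟩).1 h')
      exact (dif_neg h3).trans ((dif_neg h4).trans (dif_pos hcW))
    obtain ⟨σ, hσ⟩ := exists_sec_of_grm F g (by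
      rintro _ ⟨d, hd, rfl⟩
      rcases lt_trichotomy d c with hdc | rfl | hdc
      · exact ⟨arc α c, ex_mem_arc hd.1 hdc, hL, σL, fun y hy => (hgL (hL hy) hy).symm⟩
      · refine ⟨arc (d - ε) (d + ε), ex_mem_arc (by linarith) (by linarith), arc_mono hα hβ,
          res F hWε τ, ?_⟩
        rintro _ ⟨d', hd', rfl⟩
        refine (grm_res F hWε _ τ).trans ?_
        rcases lt_trichotomy d' d with h | rfl | h
        · have h3 : ex d' ∈ arc (d - ε) d := ex_mem_arc hd'.1 h
          rw [hgL (hL (arc_mono hα le_rfl h3)) (arc_mono hα le_rfl h3), ← grm_res F (arc_mono hα le_rfl) h3, hσL,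
            grm_res]
        · exact hgc.symm
        · have h3 : ex d' ∈ arc d (d + ε) := ex_mem_arc h hd'.2
          rw [hgR (hR (arc_mono le_rfl hβ h3)) (arc_mono le_rfl hβ h3), ← grm_res F (arc_mono le_rfl hβ) h3, hσR,
            grm_res]
      · exact ⟨arc c β, ex_mem_arc hdc hd.2, hR, σR, fun y hy => (hgR (hR hy) hy).symm⟩)
    exact ⟨σ, (hσ _ _).trans hgc⟩

/-- By compactness there are finitely many strata, so the point strata fit into the even points of a
grid. Odd cells then lie in open strata, where the sheaf is constant, and at an even point the
bijectivity follows from the two sides. -/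
theorem IsConstructible.exists_adapted {F : Sh k circle.{u}} (hF : IsConstructible F) :
    ∃ Q : Grid, Adapted Q F := by
  obtain ⟨S, hS, hconst⟩ := hF
  have hSfin : S.Finite := by
    have := hS.locallyFinite.finite_of_compact fun s => (hS.isConnected s.1 s.2).nonempty
    exact Set.finite_coe_iff.1 (Set.finite_univ_iff.1 this)
  have hPfin : {x : circle.{u} | {x} ∈ S}.Finite :=
    hSfin.preimage Set.singleton_injective.injOn
  obtain ⟨Q, hQ⟩ := exists_grid hPfin
  have hodd : ∀ {α β d : ℝ} (_ : ∀ d ∈ Set.Ioo α β, ¬ Even (Q.idx d)) (h : α < d) (h' : d < β),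
      Function.Bijective (grm F (ex_mem_arc h h')) := by
    intro α β d hno h h'
    obtain ⟨s, hs, hso, hsub⟩ := exists_stratum_of_arc hS h h' fun d hd hdS =>
      hno d hd (hQ d hdS)
    exact grm_bijective_of_isConstant F hso (hconst s hs) hsub (isPreconnected_arc _ _) _
  have hfin : ∀ x : circle.{u}, Module.Finite k (Stalk F x) := fun x => by
    obtain ⟨s, ⟨hs, hxs⟩, -⟩ := hS.isPartition.2 x
    exact finite_stalk_of_isConstant_restrict F (hconst s hs) ⟨x, hxs⟩
  have hbij : ∀ {n c α β}, Q.Cell n c → Q.q (n - 1) ≤ α → β ≤ Q.q (n + 1) →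
      ∀ (h1 : α < c) (h2 : c < β), Function.Bijective (grm F (ex_mem_arc h1 h2)) := by
    intro n c α β hc hα hβ h1 h2
    by_cases hn : Even n
    · have hcn := hc.2.2 hn
      have h3 := Q.q_gap (n - 1)
      rw [show n - 1 + 2 = n + 1 by ring] at h3
      refine grm_bijective_of_sides F h1 h2 (by linarith [Real.pi_pos]) ?_
      intro α' β' d hα' hβ' hside h h'
      refine hodd (fun x hx => ?_) h h'
      rcases hside with hs | hs
      · have : Q.idx x = n - 1 := Q.idx_eq_iff.2 <| Q.cell_of_odd
          (by rw [Int.not_even_iff_odd]; exact hn.sub_odd odd_one)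
          ((Q.strictMono (by omega)).trans_le (hα.trans (hα'.trans hx.1.le)))
          (by rw [sub_add_cancel, ← hcn]; exact hx.2.trans_le hs)
        rw [this, Int.not_even_iff_odd]
        exact hn.sub_odd odd_one
      · have : Q.idx x = n + 1 := Q.idx_eq_iff.2 <| Q.cell_of_odd
          (by rw [Int.not_even_iff_odd]; exact hn.add_one)
          (by rw [add_sub_cancel_right, ← hcn]; exact hs.trans_lt hx.1)
          ((hx.2.le.trans (hβ'.trans hβ)).trans_lt (Q.strictMono (by omega)))
        rw [this, Int.not_even_iff_odd]
        exact hn.add_one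
    · refine hodd (fun x hx => ?_) h1 h2
      rwa [Q.idx_eq_iff.2 (Q.cell_of_odd hn (hα.trans_lt hx.1) (hx.2.trans_le hβ))]
  refine ⟨Q, fun n => ?_, hbij⟩
  -- Sections over a star embed in the stalk at its centre.
  have := hfin (ex (Q.q n))
  exact Module.Finite.of_injective _
    (hbij (Q.cell_q n) le_rfl le_rfl (Q.cell_q n).1 (Q.cell_q n).2.1).1

/-! ### The chain of relations of an adapted sheaf -/

/-- The pairs of sections that agree on the intersection. -/
def agree {X : TopCat.{u}} (F : Sh k X) (U V : Opens X) : Submodule k (Sec F U × Sec F V) :=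
  LinearMap.ker (res F (inf_le_left : U ⊓ V ≤ U) ∘ₗ LinearMap.fst k _ _ -
    res F (inf_le_right : U ⊓ V ≤ V) ∘ₗ LinearMap.snd k _ _)

theorem mem_agree {X : TopCat.{u}} {F : Sh k X} {U V : Opens X} {p : Sec F U × Sec F V} :
    p ∈ agree F U V ↔ res F inf_le_left p.1 = res F inf_le_right p.2 := by
  simp [agree, sub_eq_zero]

theorem grm_eq_of_mem_agree {X : TopCat.{u}} {F : Sh k X} {U V : Opens X} {p : Sec F U × Sec F V}
    (h : p ∈ agree F U V) {x : X} (hU : x ∈ U) (hV : x ∈ V) : grm F hU p.1 = grm F hV p.2 := by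
  have hx : x ∈ U ⊓ V := ⟨hU, hV⟩
  rw [← grm_res F inf_le_left hx, mem_agree.1 h, grm_res]

theorem Grid.star_add (Q : Grid) (n j : ℤ) : Q.star.{u} (n + Q.M * j) = Q.star n := by
  rw [Grid.star, Grid.star, show n + Q.M * j - 1 = n - 1 + Q.M * j by ring,
    show n + Q.M * j + 1 = n + 1 + Q.M * j by ring, Q.q_add_mul_M, Q.q_add_mul_M, arc_add]

theorem Grid.star_inf_star (Q : Grid) (n : ℤ) :
    Q.star.{u} n ⊓ Q.star (n + 1) = arc (Q.q n) (Q.q (n + 1)) := by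
  have h1 := Q.q_add_three_le (n - 1)
  rw [show n - 1 + 3 = n + 1 + 1 by ring] at h1
  have h2 := Q.q_lt (n - 1)
  rw [sub_add_cancel] at h2
  have h3 := Q.q_lt (n + 1)
  rw [Grid.star, Grid.star, arc_inf_arc le_rfl (h3.le.trans h1) (by simpa using h2.le) h1]
  congr 1
  · rw [add_sub_cancel_right, max_eq_right h2.le]
  · exact min_eq_left h3.le

theorem Grid.Cell.ex_mem_star {Q : Grid} {n : ℤ} {c : ℝ} (h : Q.Cell n c) : ex.{u} c ∈ Q.star n :=
  ex_mem_arc h.1 h.2.1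

/-- The relations between sections over consecutive stars. -/
abbrev starRel (Q : Grid) (F : Sh k circle.{u}) (n : ℤ) :
    Submodule k (Sec F (Q.star n) × Sec F (Q.star (n + 1))) :=
  agree F (Q.star n) (Q.star (n + 1))

theorem Grid.mem_star_left (Q : Grid) {n : ℤ} {d : ℝ} (h1 : Q.q n < d) (h2 : d < Q.q (n + 1)) :
    ex.{u} d ∈ Q.star n :=
  ex_mem_arc ((Q.strictMono (by omega)).trans h1) h2

theorem Grid.mem_star_right (Q : Grid) {n : ℤ} {d : ℝ} (h1 : Q.q n < d) (h2 : d < Q.q (n + 1)) :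
    ex.{u} d ∈ Q.star (n + 1) :=
  ex_mem_arc (by simpa using h1) (h2.trans (Q.q_lt _))

theorem Grid.cell_left (Q : Grid) {n : ℤ} (hn : ¬ Even n) {d : ℝ} (h1 : Q.q n < d)
    (h2 : d < Q.q (n + 1)) : Q.Cell n d :=
  Q.cell_of_odd hn ((Q.strictMono (by omega)).trans h1) h2

theorem Grid.cell_right (Q : Grid) {n : ℤ} (hn : Even n) {d : ℝ} (h1 : Q.q n < d)
    (h2 : d < Q.q (n + 1)) : Q.Cell (n + 1) d :=
  Q.cell_of_odd (by rw [Int.not_even_iff_odd]; exact hn.add_one) (by simpa using h1)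
    (h2.trans (Q.q_lt _))

namespace Adapted

variable {Q : Grid} {F : Sh k circle.{u}} (hF : Adapted Q F)

include hF

theorem star_bijective {n : ℤ} {c : ℝ} (h : Q.Cell n c) :
    Function.Bijective (grm F h.ex_mem_star) :=
  hF.bij h le_rfl le_rfl h.1 h.2.1

/-- The overlap lies in the odd one of the two cells, where a section is determined by its germ at
any one point. -/
theorem mem_starRel {n : ℤ} {d : ℝ} (h1 : Q.q n < d) (h2 : d < Q.q (n + 1))
    {p : Sec F (Q.star n) × Sec F (Q.star (n + 1))} : p ∈ starRel Q F n ↔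
      grm F (Q.mem_star_left h1 h2) p.1 = grm F (Q.mem_star_right h1 h2) p.2 := by
  refine ⟨fun h => grm_eq_of_mem_agree h _ _, fun h => ?_⟩
  have hb : Function.Injective (grm F (ex_mem_arc h1 h2)) := by
    by_cases hn : Even n
    · exact (hF.bij (Q.cell_right hn h1 h2) (by simp) (Q.q_lt _).le h1 h2).1
    · exact (hF.bij (Q.cell_left hn h1 h2) (Q.strictMono (by omega)).le le_rfl h1 h2).1
  rw [mem_agree]
  have key : res F (Q.star_inf_star n).ge (res F inf_le_left p.1) =
      res F (Q.star_inf_star n).ge (res F inf_le_right p.2) := by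
    apply hb
    simpa using h
  have := congrArg (res F (Q.star_inf_star n).le) key
  simpa using this

/-- For even `n` the star `n + 1` is an odd cell, whose sections are the germs at any of its points.
With `right_eq_zero` this makes the relation the graph of a map to the right, the generization map
out of the special point. -/
theorem exists_right {n : ℤ} (hn : Even n) (σ : Sec F (Q.star n)) : ∃ τ, (σ, τ) ∈ starRel Q F n := by
  obtain ⟨d, h1, h2⟩ := exists_between (Q.q_lt n)
  obtain ⟨τ, hτ⟩ := (hF.star_bijective (Q.cell_right hn h1 h2)).2 (grm F (Q.mem_star_left h1 h2) σ)
  exact ⟨τ, (hF.mem_starRel h1 h2).2 hτ.symm⟩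

theorem right_eq_zero {n : ℤ} (hn : Even n) {τ : Sec F (Q.star (n + 1))}
    (h : (0, τ) ∈ starRel Q F n) : τ = 0 := by
  obtain ⟨d, h1, h2⟩ := exists_between (Q.q_lt n)
  apply (hF.star_bijective (Q.cell_right hn h1 h2)).1
  simpa using ((hF.mem_starRel h1 h2).1 h).symm

/-- Mirror image of the even case: with `left_eq_zero`, the relation at an odd index is the graph of
a map to the left. -/
theorem exists_left {n : ℤ} (hn : ¬ Even n) (τ : Sec F (Q.star (n + 1))) :
    ∃ σ, (σ, τ) ∈ starRel Q F n := by
  obtain ⟨d, h1, h2⟩ := exists_between (Q.q_lt n)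
  obtain ⟨σ, hσ⟩ := (hF.star_bijective (Q.cell_left hn h1 h2)).2 (grm F (Q.mem_star_right h1 h2) τ)
  exact ⟨σ, (hF.mem_starRel h1 h2).2 hσ⟩

theorem left_eq_zero {n : ℤ} (hn : ¬ Even n) {σ : Sec F (Q.star n)}
    (h : (σ, 0) ∈ starRel Q F n) : σ = 0 := by
  obtain ⟨d, h1, h2⟩ := exists_between (Q.q_lt n)
  apply (hF.star_bijective (Q.cell_left hn h1 h2)).1
  simpa using (hF.mem_starRel h1 h2).1 h

/-- If all relations are bijective, the sheaf is locally constant. -/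
theorem isLocallyConstant
    (hr : ∀ n, (∀ τ : Sec F (Q.star (n + 1)), (0, τ) ∈ starRel Q F n → τ = 0) ∧
      ∀ τ, ∃ σ, (σ, τ) ∈ starRel Q F n)
    (hl : ∀ n, (∀ σ : Sec F (Q.star n), (σ, 0) ∈ starRel Q F n → σ = 0) ∧
      ∀ σ, ∃ τ, (σ, τ) ∈ starRel Q F n) : IsLocallyConstantOfFiniteRank F := by
  intro x
  obtain ⟨c, rfl⟩ := ex_surjective x
  obtain ⟨m, hm⟩ : ∃ m, m + 1 = Q.idx c := ⟨Q.idx c - 1, by ring⟩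
  have hc := Q.cell_idx c
  rw [← hm] at hc
  refine ⟨Q.star (m + 1), (Q.star (m + 1)).isOpen, hc.ex_mem_star,
    isConstant_restrict_of_grm_bijective F _ (hF.fin _) ?_⟩
  rintro _ ⟨d, ⟨hd1, hd2⟩, rfl⟩
  rw [add_sub_cancel_right] at hd1
  -- Only the star of a special point meets other cells; a germ there is compared with a section of
  -- the neighbouring star through the relation `m` or `m + 1`.
  by_cases hodd : Even (m + 1)
  · rcases lt_trichotomy d (Q.q (m + 1)) with h | rfl | h
    · have hm' : ¬ Even m := by
        rw [Int.even_add_one] at hodd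
        exact hodd
      constructor
      · rw [injective_iff_map_eq_zero]
        intro σ hσ
        exact (hr m).1 σ ((hF.mem_starRel hd1 h).2 (by simpa using hσ.symm))
      · intro v
        obtain ⟨τ, rfl⟩ := (hF.star_bijective (Q.cell_left hm' hd1 h)).2 v
        obtain ⟨σ, hσ⟩ := (hl m).2 τ
        exact ⟨σ, ((hF.mem_starRel hd1 h).1 hσ).symm⟩
    · exact hF.star_bijective (Q.cell_q _)
    · constructor
      · rw [injective_iff_map_eq_zero]
        intro σ hσ
        exact (hl (m + 1)).1 σ ((hF.mem_starRel h hd2).2 (by simpa using hσ))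
      · intro v
        obtain ⟨τ, rfl⟩ := (hF.star_bijective (Q.cell_right hodd h hd2)).2 v
        obtain ⟨σ, hσ⟩ := (hr (m + 1)).2 τ
        exact ⟨σ, (hF.mem_starRel h hd2).1 hσ⟩
  · exact hF.star_bijective (Q.cell_of_odd hodd (by simpa using hd1) hd2)

/-- Periodicity bounds the dimensions and repeats any kernel or cokernel arbitrarily far to the
right, which is what the two string lemmas need. Without defects all relations are bijective. -/
theorem exists_isString_or_isLocallyConstant : IsLocallyConstantOfFiniteRank F ∨
    ∃ i n x t, LinRel.IsString (starRel Q F) i n x t := by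
  have hfin := hF.fin
  have hMpos := Q.M_pos
  have hrank : ∀ i j, Module.finrank k (Sec F (Q.star (i + Q.M * j))) =
      Module.finrank k (Sec F (Q.star i)) := fun i j => by rw [Q.star_add]
  obtain ⟨B, hB⟩ : ∃ B, ∀ i, Module.finrank k (Sec F (Q.star i)) ≤ B := by
    refine ⟨(Finset.Ico 0 Q.M).sup fun i => Module.finrank k (Sec F (Q.star i)), fun i => ?_⟩
    have h1 : i % Q.M ∈ Finset.Ico 0 Q.M :=
      Finset.mem_Ico.2 ⟨Int.emod_nonneg _ hMpos.ne', Int.emod_lt_of_pos _ hMpos⟩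
    have h2 := hrank (i % Q.M) (i / Q.M)
    rw [Int.emod_add_mul_ediv] at h2
    rw [h2]
    exact Finset.le_sup (f := fun i => Module.finrank k (Sec F (Q.star i))) h1
  -- The defect is phrased as a property of a pair of open sets, because stars a period apart are
  -- equal as open sets; no transport of sections is then required.
  have hshift : ∀ (P : Opens circle.{u} → Opens circle.{u} → Prop) (i : ℤ),
      P (Q.star i) (Q.star (i + 1)) → ∀ N : ℤ, ∃ i, N ≤ i ∧ P (Q.star i) (Q.star (i + 1)) := by
    intro P i hi N
    refine ⟨i + Q.M * (|N| + |i|), ?_, ?_⟩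
    · have h1 : (1 : ℤ) * (|N| + |i|) ≤ Q.M * (|N| + |i|) := by
        apply mul_le_mul_of_nonneg_right (by omega)
        positivity
      have h2 := le_abs_self N
      have h3 := neg_abs_le i
      omega
    · rwa [Q.star_add, add_right_comm, Q.star_add]
  by_cases h1 : ∃ i, ∃ x : Sec F (Q.star (i + 1)), x ≠ 0 ∧ (0, x) ∈ starRel Q F i
  · right
    obtain ⟨i, hi⟩ := h1
    exact LinRel.exists_isString_of_kernel B hB
      (hshift (fun U V => ∃ x : Sec F V, x ≠ 0 ∧ (0, x) ∈ agree F U V) i hi)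
  by_cases h2 : ∃ i, ∃ y : Sec F (Q.star (i + 1)), ∀ x, (x, y) ∉ starRel Q F i
  · right
    obtain ⟨i, hi⟩ := h2
    exact LinRel.exists_isString_of_cokernel B hB
      (hshift (fun U V => ∃ y : Sec F V, ∀ x, (x, y) ∉ agree F U V) i hi)
  · left
    push Not at h1 h2
    have h1' : ∀ i (x : Sec F (Q.star (i + 1))), (0, x) ∈ starRel Q F i → x = 0 := fun i x hx => by
      by_contra h
      exact h1 i x h hx
    refine hF.isLocallyConstant (fun n => ⟨h1' n, h2 n⟩) ?_
    refine LinRel.bijective_of_periodic hMpos (fun i => ?_) h1' h2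
    rw [← hrank i 1, mul_one]

end Adapted

/-! ### Splitting data for an interval -/

/-- Transport of stalks along an equality of points. -/
def castStalk {X : TopCat.{u}} (F : Sh k X) {x y : X} (h : x = y) : Stalk F x →ₗ[k] Stalk F y :=
  h ▸ LinearMap.id

@[simp] theorem castStalk_grm {X : TopCat.{u}} (F : Sh k X) {x y : X} (h : x = y) {U : Opens X}
    (hx : x ∈ U) (σ : Sec F U) : castStalk F h (grm F hx σ) = grm F (h ▸ hx : y ∈ U) σ := by
  subst h
  rfl

@[simp] theorem castStalk_rfl {X : TopCat.{u}} (F : Sh k X) {x : X} (h : x = x) (v : Stalk F x) :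
    castStalk F h v = v := rfl

/-- A section `s` of the inverse image of `F` on the line with support in `I`, and a morphism `t`
from this inverse image to the constant sheaf on `I`, which pair to one. -/
structure SplitData (F : Sh k circle.{u}) (I : Set ℝ) where
  /-- the values of the section -/
  s : ∀ c, Stalk F (ex c)
  /-- the values of the morphism -/
  t : ∀ c, Module.Dual k (Stalk F (ex c))
  s_zero : ∀ c ∉ I, s c = 0
  t_zero : ∀ c ∉ I, t c = 0
  -- Nothing is asked outside `I`: there `s` only ever multiplies sections of `k_I`, which vanish
  -- nearby.
  s_local : ∀ c ∈ I, ∃ (U : Opens circle.{u}) (_ : ex c ∈ U) (σ : Sec F U),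
    ∀ᶠ c' in 𝓝 c, ∀ h : ex c' ∈ U, grm F h σ = s c'
  -- The exempted case is the jump allowed to sections of `k_I` at a closed end of `I`. At `c ∉ I`
  -- there is no exemption, so the values vanish near `c`.
  t_local : ∀ (U : Opens circle.{u}) (σ : Sec F U) (c : ℝ) (hc : ex c ∈ U),
    ∀ᶠ c' in 𝓝 c, ∀ h : ex c' ∈ U, (c ∈ I ∧ c' ∉ I) ∨ t c' (grm F h σ) = t c (grm F hc σ)
  pairing : ∀ c ∈ I, t c (s c) = 1
  -- `I` may contain several points of one fibre of `e`; the cross pairings need only vanish in one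
  -- direction along the fibre.
  triangular : (∀ c c' (h : ex c' = ex c), c' < c → t c (castStalk F h (s c')) = 0) ∨
    (∀ c c' (h : ex c' = ex c), c < c' → t c (castStalk F h (s c')) = 0)

theorem res_mem_agree {X : TopCat.{u}} {F : Sh k X} {U V U' V' : Opens X} (hU : U ≤ U')
    (hV : V ≤ V') {p : Sec F U' × Sec F V'} (h : p ∈ agree F U' V') :
    (res F hU p.1, res F hV p.2) ∈ agree F U V := by
  have h1 := congrArg (res F (inf_le_inf hU hV)) (mem_agree.1 h)
  rw [mem_agree]
  simpa using h1

/-! ### Split data from a string -/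

namespace LinRel.IsString

variable {Q : Grid} {F : Sh k circle.{u}} (hF : Adapted Q F) {i n : ℤ}
  {x : ∀ j, Sec F (Q.star j)} {t : ∀ j, Module.Dual k (Sec F (Q.star j))}
  (hs : LinRel.IsString (starRel Q F) i n x t)

include hs

theorem pairing_eq_one (j : ℤ) (h1 : i + 1 ≤ j) (h2 : j ≤ n) : t j (x j) = 1 := by
  obtain ⟨d, hd⟩ := Int.le.dest h2
  induction d generalizing j with
  | zero =>
    obtain rfl : j = n := by simpa using hd
    exact hs.pairing
  | succ d ih =>
    push_cast at hd
    have h3 := hs.dual_chain j h1 (by omega) _ (hs.chain j h1 (by omega))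
    exact h3.trans (ih (j + 1) (by omega) (by omega) (by omega))

include hF

/-- The parity of `i` selects the end condition, since the other would contradict the pairing being
one. Odd `i` means a closed left end at `q (i + 1)`, past which the vectors continue by zero; even
`i` means an open left end at `q i`, past which the functionals do. -/
theorem left_end : (¬ Even i ∧ (0, x (i + 1)) ∈ starRel Q F i) ∨
    (Even i ∧ ∀ p ∈ starRel Q F i, t (i + 1) p.2 = 0) := by
  have h1 := hs.pairing_eq_one (i + 1) le_rfl hs.le
  by_cases hi : Even i
  · rcases hs.left with h | h
    · rw [hF.right_eq_zero hi h] at h1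
      simp at h1
    · exact Or.inr ⟨hi, h⟩
  · rcases hs.left with h | h
    · exact Or.inl ⟨hi, h⟩
    · obtain ⟨σ, hσ⟩ := hF.exists_left hi (x (i + 1))
      rw [h _ hσ] at h1
      simp at h1

theorem right_end : (Even n ∧ (x n, 0) ∈ starRel Q F n) ∨
    (¬ Even n ∧ ∀ p ∈ starRel Q F n, t n p.1 = 0) := by
  have h1 := hs.pairing
  by_cases hn : Even n
  · rcases hs.right with h | h
    · exact Or.inl ⟨hn, h⟩
    · obtain ⟨σ, hσ⟩ := hF.exists_right hn (x n)
      rw [h _ hσ] at h1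
      simp at h1
  · rcases hs.right with h | h
    · rw [hF.left_eq_zero hn h] at h1
      simp at h1
    · exact Or.inr ⟨hn, h⟩

omit hF in
-- A vector is compared with a functional belonging to another index, in practice some full turns
-- away. Restriction between the stars replaces transport along their equality.
theorem pairing_step {m m' : ℤ} (hm : i + 1 ≤ m) (hmn : m + 1 ≤ n) (hm' : i + 1 ≤ m')
    (hmn' : m' + 1 ≤ n) (h : Q.star.{u} m ≤ Q.star m') (h' : Q.star.{u} (m + 1) ≤ Q.star (m' + 1)) :
    t m (res F h (x m')) = t (m + 1) (res F h' (x (m' + 1))) :=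
  hs.dual_chain m hm (by omega) _ (res_mem_agree h h' (hs.chain m' hm' (by omega)))

/-- Slide both indices to the left until the vector reaches the closed end of the string. It
continues there by zero, while the functional, lying further right, still has room to move. -/
theorem pairing_eq_zero_of_not_even (hi : ¬ Even i) {j : ℤ} (hj : j < 0) (m m' : ℤ)
    (hmm' : m' = m + Q.M * j) (hm' : i + 1 ≤ m') (hmn : m ≤ n) (h : Q.star.{u} m ≤ Q.star m') :
    t m (res F h (x m')) = 0 := by
  have hMj : Q.M * j < 0 := mul_neg_of_pos_of_neg Q.M_pos hj
  obtain ⟨d, hd⟩ := Int.le.dest hm'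
  induction d generalizing m m' with
  | zero =>
    obtain rfl : m' = i + 1 := by simpa using hd.symm
    obtain ⟨l, rfl⟩ : ∃ l, m = l + 1 := ⟨m - 1, by ring⟩
    have hl : l + Q.M * j = i := by omega
    have h1 : (0, x (i + 1)) ∈ starRel Q F i := by
      rcases hs.left_end hF with h | h
      · exact h.2
      · exact absurd h.1 hi
    have h2 : Q.star.{u} l ≤ Q.star i := by rw [← hl, Q.star_add]
    have h3 := hs.dual_chain l (by omega) (by omega) _ (res_mem_agree h2 h h1)
    simpa using h3.symm
  | succ d ih =>
    obtain ⟨l, rfl⟩ : ∃ l, m = l + 1 := ⟨m - 1, by ring⟩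
    obtain ⟨l', rfl⟩ : ∃ l', m' = l' + 1 := ⟨m' - 1, by ring⟩
    push_cast at hd
    have hl : l' = l + Q.M * j := by omega
    have h2 : Q.star.{u} l ≤ Q.star l' := by rw [hl, Q.star_add]
    rw [← hs.pairing_step (by omega) hmn (by omega) (by omega) h2 h]
    exact ih l l' hl (by omega) (by omega) h2 (by omega)

/-- Here the functional reaches the left end first. As that end is open, the functional kills
everything arriving from the left, in particular the vector of the string there. -/
theorem pairing_eq_zero_of_even (hi : Even i) {j : ℤ} (hj : 0 < j) (m m' : ℤ)
    (hmm' : m' = m + Q.M * j) (hm : i + 1 ≤ m) (hmn : m' ≤ n) (h : Q.star.{u} m ≤ Q.star m') :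
    t m (res F h (x m')) = 0 := by
  have hMj : 0 < Q.M * j := mul_pos Q.M_pos hj
  obtain ⟨d, hd⟩ := Int.le.dest hm
  induction d generalizing m m' with
  | zero =>
    obtain rfl : m = i + 1 := by simpa using hd.symm
    obtain ⟨l, rfl⟩ : ∃ l, m' = l + 1 := ⟨m' - 1, by ring⟩
    have hl : l = i + Q.M * j := by omega
    have h1 : ∀ p ∈ starRel Q F i, t (i + 1) p.2 = 0 := by
      rcases hs.left_end hF with h | h
      · exact absurd hi h.1
      · exact h.2
    have h2 : Q.star.{u} i ≤ Q.star l := by rw [hl, Q.star_add]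
    exact h1 _ (res_mem_agree h2 h (hs.chain l (by omega) (by omega)))
  | succ d ih =>
    obtain ⟨l, rfl⟩ : ∃ l, m = l + 1 := ⟨m - 1, by ring⟩
    obtain ⟨l', rfl⟩ : ∃ l', m' = l' + 1 := ⟨m' - 1, by ring⟩
    push_cast at hd
    have hl : l' = l + Q.M * j := by omega
    have h2 : Q.star.{u} l ≤ Q.star l' := by rw [hl, Q.star_add]
    rw [← hs.pairing_step (by omega) (by omega) (by omega) hmn h2 h]
    exact ih l l' hl (by omega) (by omega) h2 (by omega)

/-- The split data on the line defined by a string. -/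
theorem exists_splitData :
    Nonempty (SplitData F {c | i + 1 ≤ Q.idx c ∧ Q.idx c ≤ n}) := by
  classical
  set I : Set ℝ := {c | i + 1 ≤ Q.idx c ∧ Q.idx c ≤ n} with hI
  -- Vectors and functionals are extended by zero to all indices; the four facts `hxright`,
  -- `hxleft`, `htright` and `htleft` say how far compatibility survives at the ends.
  let x' : ∀ j, Sec F (Q.star j) := fun j => if i + 1 ≤ j ∧ j ≤ n then x j else 0
  let t' : ∀ j, Module.Dual k (Sec F (Q.star j)) := fun j => if i + 1 ≤ j ∧ j ≤ n then t j else 0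
  have hx' : ∀ {j}, i + 1 ≤ j → j ≤ n → x' j = x j := fun h1 h2 => if_pos ⟨h1, h2⟩
  have ht' : ∀ {j}, i + 1 ≤ j → j ≤ n → t' j = t j := fun h1 h2 => if_pos ⟨h1, h2⟩
  have hx0 : ∀ {j}, ¬ (i + 1 ≤ j ∧ j ≤ n) → x' j = 0 := fun h => if_neg h
  have ht0 : ∀ {j}, ¬ (i + 1 ≤ j ∧ j ≤ n) → t' j = 0 := fun h => if_neg h
  let γ : ∀ c, Sec F (Q.star (Q.idx c)) ≃ₗ[k] Stalk F (ex c) := fun c =>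
    LinearEquiv.ofBijective _ (hF.star_bijective (Q.cell_idx c))
  have hγ : ∀ c σ, γ c σ = grm F (Q.cell_idx c).ex_mem_star σ := fun _ _ => rfl
  let s : ∀ c, Stalk F (ex c) := fun c => γ c (x' (Q.idx c))
  let τ : ∀ c, Module.Dual k (Stalk F (ex c)) := fun c => t' (Q.idx c) ∘ₗ (γ c).symm.toLinearMap
  have hsv : ∀ {m c} (h : Q.Cell m c), s c = grm F h.ex_mem_star (x' m) := by
    intro m c h
    obtain rfl := Q.idx_eq_iff.2 h
    rfl
  have hτv : ∀ {m c} (h : Q.Cell m c) (σ : Sec F (Q.star m)),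
      τ c (grm F h.ex_mem_star σ) = t' m σ := by
    intro m c h σ
    obtain rfl := Q.idx_eq_iff.2 h
    change t' _ ((γ c).symm (γ c σ)) = _
    rw [LinearEquiv.symm_apply_apply]
  have hxright : ∀ {m}, Even m → i + 1 ≤ m → m ≤ n → (x' m, x' (m + 1)) ∈ starRel Q F m := by
    intro m hm h1 h2
    rw [hx' h1 h2]
    rcases h2.lt_or_eq with h | rfl
    · rw [hx' (by omega) h]
      exact hs.chain m h1 h
    · rw [hx0 (by omega)]
      rcases hs.right_end hF with h | h
      · exact h.2
      · exact absurd hm h.1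
  have hxleft : ∀ {l}, ¬ Even l → i + 1 ≤ l + 1 → l + 1 ≤ n → (x' l, x' (l + 1)) ∈ starRel Q F l := by
    intro l hl h1 h2
    rw [hx' h1 h2]
    rcases (show i < l ∨ i = l by omega) with h | rfl
    · rw [hx' (by omega) (by omega)]
      exact hs.chain l (by omega) (by omega)
    · rw [hx0 (by omega)]
      rcases hs.left_end hF with h | h
      · exact h.2
      · exact absurd h.1 hl
  have htright : ∀ {m}, Even m → ∀ p ∈ starRel Q F m,
      ((i + 1 ≤ m ∧ m ≤ n) ∧ ¬ (i + 1 ≤ m + 1 ∧ m + 1 ≤ n)) ∨ t' (m + 1) p.2 = t' m p.1 := by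
    intro m hm p hp
    by_cases h1 : i + 1 ≤ m ∧ m ≤ n
    · by_cases h2 : i + 1 ≤ m + 1 ∧ m + 1 ≤ n
      · right
        rw [ht' h1.1 h1.2, ht' h2.1 h2.2]
        exact (hs.dual_chain m h1.1 (by omega) p hp).symm
      · exact Or.inl ⟨h1, h2⟩
    · right
      rw [ht0 h1]
      by_cases h2 : i + 1 ≤ m + 1 ∧ m + 1 ≤ n
      · obtain rfl : m = i := by omega
        rw [ht' h2.1 h2.2]
        rcases hs.left_end hF with h | h
        · exact absurd hm h.1
        · exact h.2 p hp
      · rw [ht0 h2]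
        rfl
  have htleft : ∀ {l}, ¬ Even l → ∀ p ∈ starRel Q F l,
      ((i + 1 ≤ l + 1 ∧ l + 1 ≤ n) ∧ ¬ (i + 1 ≤ l ∧ l ≤ n)) ∨ t' l p.1 = t' (l + 1) p.2 := by
    intro l hl p hp
    by_cases h1 : i + 1 ≤ l + 1 ∧ l + 1 ≤ n
    · by_cases h2 : i + 1 ≤ l ∧ l ≤ n
      · right
        rw [ht' h1.1 h1.2, ht' h2.1 h2.2]
        exact hs.dual_chain l h2.1 (by omega) p hp
      · exact Or.inl ⟨h1, h2⟩
    · right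
      rw [ht0 h1]
      by_cases h2 : i + 1 ≤ l ∧ l ≤ n
      · obtain rfl : l = n := by omega
        rw [ht' h2.1 h2.2]
        rcases hs.right_end hF with h | h
        · exact absurd h.1 hl
        · exact h.2 p hp
      · rw [ht0 h2]
        rfl
  have hmemI : ∀ {m c}, Q.Cell m c → (c ∈ I ↔ i + 1 ≤ m ∧ m ≤ n) := by
    intro m c h
    obtain rfl := Q.idx_eq_iff.2 h
    exact Iff.rfl
  have hnear : ∀ c, ∀ᶠ c' in 𝓝 c, Q.q (Q.idx c - 1) < c' ∧ c' < Q.q (Q.idx c + 1) := fun c =>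
    (eventually_gt_nhds (Q.cell_idx c).1).and (eventually_lt_nhds (Q.cell_idx c).2.1)
  have hcast : ∀ c c' (h : ex.{u} c' = ex c) (hst : Q.star.{u} (Q.idx c) ≤ Q.star (Q.idx c')),
      τ c (castStalk F h (s c')) = t' (Q.idx c) (res F hst (x' (Q.idx c'))) := by
    intro c c' h hst
    rw [← hτv (Q.cell_idx c), grm_res, hsv (Q.cell_idx c'), castStalk_grm]
  refine ⟨⟨s, τ, fun c hc => ?_, fun c hc => ?_, fun c hc => ?_, ?_, fun c hc => ?_, ?_⟩⟩
  · rw [hsv (Q.cell_idx c), hx0 hc, map_zero]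
  · change t' _ ∘ₗ _ = 0
    rw [ht0 hc, LinearMap.zero_comp]
  · refine ⟨Q.star (Q.idx c), (Q.cell_idx c).ex_mem_star, x' (Q.idx c), ?_⟩
    filter_upwards [hnear c] with c' hc' h
    by_cases hm : Even (Q.idx c)
    · have hcq := (Q.cell_idx c).2.2 hm
      rcases lt_trichotomy c' c with h1 | rfl | h1
      · obtain ⟨l, hl⟩ : ∃ l, Q.idx c = l + 1 := ⟨Q.idx c - 1, by ring⟩
        have hc2 : i + 1 ≤ Q.idx c ∧ Q.idx c ≤ n := hc
        -- The index must be a variable before it can be replaced by `l + 1` in the dependent types.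
        generalize Q.idx c = m at *
        subst hl
        have hl' : ¬ Even l := by
          rw [Int.even_add_one] at hm
          exact hm
        rw [add_sub_cancel_right] at hc'
        rw [hcq] at h1
        rw [hsv (Q.cell_left hl' hc'.1 h1)]
        exact (grm_eq_of_mem_agree (hxleft hl' hc2.1 hc2.2) _ _).symm
      · rfl
      · rw [hcq] at h1
        rw [hsv (Q.cell_right hm h1 hc'.2)]
        exact grm_eq_of_mem_agree (hxright hm hc.1 hc.2) _ _
    · rw [hsv (Q.cell_of_odd hm hc'.1 hc'.2)]
  · intro U σ c hc
    obtain ⟨σ', hσ'⟩ := (hF.star_bijective (Q.cell_idx c)).2 (grm F hc σ)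
    obtain ⟨W, hcW, hW1, hW2, hW⟩ := exists_res_eq F _ _ σ' σ hσ'
    filter_upwards [hnear c, eventually_ex_mem hcW] with c' hc' hc'W h
    have h2 : grm F h σ = grm F (hW1 hc'W) σ' := by
      rw [← grm_res F hW2 hc'W, ← hW, grm_res]
    rw [h2, ← hσ', hτv (Q.cell_idx c), hmemI (Q.cell_idx c)]
    have hcq := (Q.cell_idx c).2.2
    clear hσ' hW h2
    generalize hW1 hc'W = h3
    clear hW1
    generalize Q.idx c = m at *
    by_cases hm : Even m
    · have hcq := hcq hm
      rcases lt_trichotomy c' c with h1 | rfl | h1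
      · obtain ⟨l, rfl⟩ : ∃ l, m = l + 1 := ⟨m - 1, by ring⟩
        have hl' : ¬ Even l := by
          rw [Int.even_add_one] at hm
          exact hm
        rw [add_sub_cancel_right] at hc'
        rw [hcq] at h1
        obtain ⟨ρ, hρ⟩ := hF.exists_left hl' σ'
        have h4 := grm_eq_of_mem_agree hρ (Q.mem_star_left hc'.1 h1) h3
        rw [← h4, hτv (Q.cell_left hl' hc'.1 h1), hmemI (Q.cell_left hl' hc'.1 h1)]
        exact htleft hl' _ hρ
      · right
        have h5 : Q.Cell m c' := by rw [hcq]; exact Q.cell_q m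
        exact hτv h5 σ'
      · rw [hcq] at h1
        obtain ⟨ρ, hρ⟩ := hF.exists_right hm σ'
        have h4 := grm_eq_of_mem_agree hρ h3 (Q.mem_star_right h1 hc'.2)
        rw [h4, hτv (Q.cell_right hm h1 hc'.2), hmemI (Q.cell_right hm h1 hc'.2)]
        exact htright hm _ hρ
    · right
      exact hτv (Q.cell_of_odd hm hc'.1 hc'.2) σ'
  · rw [hsv (Q.cell_idx c), hτv (Q.cell_idx c), hx' hc.1 hc.2, ht' hc.1 hc.2]
    exact hs.pairing_eq_one _ hc.1 hc.2
  · have hzero : ∀ (c c' : ℝ) (h : ex.{u} c' = ex c) (hst : Q.star.{u} (Q.idx c) ≤ Q.star (Q.idx c')),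
        (i + 1 ≤ Q.idx c → Q.idx c ≤ n → i + 1 ≤ Q.idx c' → Q.idx c' ≤ n →
          t (Q.idx c) (res F hst (x (Q.idx c'))) = 0) → τ c (castStalk F h (s c')) = 0 := by
      intro c c' h hst h0
      rw [hcast c c' h hst]
      by_cases h1 : i + 1 ≤ Q.idx c ∧ Q.idx c ≤ n
      · by_cases h2 : i + 1 ≤ Q.idx c' ∧ Q.idx c' ≤ n
        · rw [ht' h1.1 h1.2, hx' h2.1 h2.2]
          exact h0 h1.1 h1.2 h2.1 h2.2
        · rw [hx0 h2, map_zero, map_zero]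
      · rw [ht0 h1]
        rfl
    have hp := Real.pi_pos
    -- The nature of the left end alone decides the direction of triangularity.
    by_cases hi : Even i
    · right
      intro c c' h hlt
      obtain ⟨j, rfl⟩ := ex_eq_iff.1 h.symm
      have hj : 0 < j := by
        have : (0 : ℝ) < j := by
          by_contra! h'
          nlinarith
        exact_mod_cast this
      have hidx := Q.idx_add c j
      exact hzero _ _ h (by rw [hidx, Q.star_add]) fun h1 h2 h3 h4 =>
        hs.pairing_eq_zero_of_even hF hi hj _ _ hidx h1 h4 _
    · left
      intro c c' h hlt
      obtain ⟨j, rfl⟩ := ex_eq_iff.1 h.symm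
      have hj : j < 0 := by
        have : (j : ℝ) < 0 := by
          by_contra! h'
          nlinarith
        exact_mod_cast this
      have hidx := Q.idx_add c j
      exact hzero _ _ h (by rw [hidx, Q.star_add]) fun h1 h2 h3 h4 =>
        hs.pairing_eq_zero_of_not_even hF hi hj _ _ hidx h3 h2 _

end LinRel.IsString

/-! ### The direct images of the interval sheaves -/

/-- The sheaf `e_* k_I`. -/
abbrev pushInterval (k : Type u) [Field k] (I : Set ℝ) : Sh k circle.{u} :=
  (eDirectImage k).obj (intervalSheaf k I 1)

/-- The value at `c` of a section of `e_* k_I`. -/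
def ival {I : Set ℝ} {U : Opens circle.{u}} {c : ℝ} (h : ex c ∈ U) :
    Sec (pushInterval k I) U →ₗ[k] k where
  toFun φ := (show extSections k line.{u} (ULift.down ⁻¹' I) (Fin 1 → k) ((Opens.map e).obj U)
    from φ).1 ⟨ULift.up c, h⟩ 0
  map_add' _ _ := rfl
  map_smul' _ _ := rfl

section

variable {I : Set ℝ} {U V : Opens circle.{u}}

theorem ival_res (hUV : U ≤ V) {c : ℝ} (h : ex c ∈ U) (φ : Sec (pushInterval k I) V) :
    ival h (res _ hUV φ) = ival (hUV h) φ := rfl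

theorem pushInterval_ext {φ ψ : Sec (pushInterval k I) U}
    (H : ∀ c (h : ex c ∈ U), ival h φ = ival h ψ) : φ = ψ := by
  apply Subtype.ext
  funext x
  obtain ⟨⟨c⟩, h⟩ := x
  funext a
  obtain rfl : a = 0 := Subsingleton.elim _ _
  exact H c h

/-- Transfer of a property near a point from the lifted line to `ℝ`. -/
theorem eventually_lift_iff {U : Opens circle.{u}} {c : ℝ} (h : ex c ∈ U)
    {p : (Opens.map e).obj U → Prop} :
    (∀ᶠ y in 𝓝 (⟨ULift.up c, h⟩ : (Opens.map e).obj U), p y) ↔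
      ∀ᶠ c' in 𝓝 c, ∀ h' : ex c' ∈ U, p ⟨ULift.up c', h'⟩ := by
  have h1 : Filter.map ULift.up.{u} (𝓝 c) = 𝓝 (ULift.up c) := Homeomorph.ulift.symm.map_nhds_eq c
  have h2 : 𝓝 (⟨ULift.up c, h⟩ : (Opens.map e).obj U) =
      Filter.comap Subtype.val (Filter.map ULift.up.{u} (𝓝 c)) :=
    nhds_subtype_eq_comap.trans (congrArg _ h1.symm)
  rw [h2]
  refine Filter.eventually_comap.trans (Filter.eventually_map.trans ?_)
  refine Filter.eventually_congr (Filter.Eventually.of_forall fun c' => ?_)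
  constructor
  · intro H h'
    exact H _ rfl
  · rintro H ⟨_, h'⟩ rfl
    exact H h'

theorem ival_eventually_zero (φ : Sec (pushInterval k I) U) {c : ℝ} (h : ex c ∈ U) (hc : c ∉ I) :
    ∀ᶠ c' in 𝓝 c, ∀ h' : ex c' ∈ U, ival h' φ = 0 := by
  have h1 := ((isExtSection_iff _ _).1 φ.2 ⟨ULift.up c, h⟩).1 hc
  have h2 := (eventually_lift_iff h).1 h1
  filter_upwards [h2] with c' hc' h'
  exact congrFun (hc' h') 0

theorem ival_eventually_eq (φ : Sec (pushInterval k I) U) {c : ℝ} (h : ex c ∈ U) (hc : c ∈ I) :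
    ∀ᶠ c' in 𝓝 c, c' ∈ I → ∀ h' : ex c' ∈ U, ival h' φ = ival h φ := by
  have h1 := ((isExtSection_iff _ _).1 φ.2 ⟨ULift.up c, h⟩).2 hc
  have h2 := (eventually_lift_iff h).1 h1
  filter_upwards [h2] with c' hc' hI h'
  exact congrFun (hc' h' hI) 0

theorem ival_eq_zero (φ : Sec (pushInterval k I) U) {c : ℝ} (h : ex c ∈ U) (hc : c ∉ I) :
    ival h φ = 0 :=
  (ival_eventually_zero φ h hc).self_of_nhds h

/-- Construct a section of `e_* k_I` from a function. -/
theorem exists_pushInterval (f : ∀ c, ex c ∈ U → k)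
    (h0 : ∀ c (_ : ex c ∈ U), c ∉ I → ∀ᶠ c' in 𝓝 c, ∀ h' : ex c' ∈ U, f c' h' = 0)
    (h1 : ∀ c (h : ex c ∈ U), c ∈ I → ∀ᶠ c' in 𝓝 c, c' ∈ I → ∀ h' : ex c' ∈ U, f c' h' = f c h) :
    ∃ φ : Sec (pushInterval k I) U, ∀ c (h : ex c ∈ U), ival h φ = f c h := by
  refine ⟨⟨fun y _ => f y.1.down y.2, ?_⟩, fun c h => rfl⟩
  refine (isExtSection_iff (V := Fin 1 → k) (U := ((Opens.map e).obj U : Set line.{u})) _ _).2 ?_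
  rintro ⟨⟨c⟩, h⟩
  constructor
  · intro hc
    refine (eventually_lift_iff h).2 ?_
    filter_upwards [h0 c h hc] with c' hc' h'
    funext _
    exact hc' h'
  · intro hc
    refine (eventually_lift_iff h).2 ?_
    filter_upwards [h1 c h hc] with c' hc' h' hI
    funext _
    exact hc' hI h'

end

/-! ### The points of a bounded set over a point of the circle -/

/-- The points of `I` over `x`. -/
abbrev Fibre (I : Set ℝ) (x : circle.{u}) : Type := {c : ℝ // ex c = x ∧ c ∈ I}

theorem mem_of_ex_eq {U : Opens circle.{u}} {x : circle.{u}} {c : ℝ} (h : ex c = x) (hx : x ∈ U) :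
    ex c ∈ U := h ▸ hx

theorem finite_fibre {I : Set ℝ} {R : ℝ} (hR : I ⊆ Set.Icc (-R) R) (x : circle.{u}) :
    Finite (Fibre I x) :=
  ((finite_ex_preimage_inter_Icc (Set.finite_singleton x) (-R) R).subset
    (fun _ hc => ⟨hc.1, hR hc.2⟩)).to_subtype

/-- The fibre varies with `c`, but a fixed finite set of translates serves for all nearby points;
this makes the fibrewise sum locally a sum of sections. -/
theorem sum_fibre {I : Set ℝ} {c : ℝ} [Fintype (Fibre I (ex.{u} c))] {V : Type*}
    [AddCommMonoid V] (J : Finset ℤ) (hJ : ∀ j : ℤ, c + 2 * Real.pi * j ∈ I → j ∈ J)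
    (f : ∀ c', ex.{u} c' = ex c → V) (hf : ∀ c' h, c' ∉ I → f c' h = 0) :
    ∑ a : Fibre I (ex.{u} c), f a.1 a.2.1 =
      ∑ j ∈ J, f (c + 2 * Real.pi * j) (ex_add c j) := by
  have hp := Real.pi_pos
  choose j hj using fun a : Fibre I (ex.{u} c) => ex_eq_iff.1 a.2.1.symm
  refine Finset.sum_of_injOn j ?_ ?_ ?_ ?_
  · intro a _ b _ hab
    apply Subtype.ext
    rw [hj a, hj b, hab]
  · intro a _
    apply hJ
    rw [← hj a]
    exact a.2.2
  · intro i _ hi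
    refine hf _ _ fun hI => hi ?_
    refine ⟨⟨_, ex_add c i, hI⟩, Finset.mem_coe.2 (Finset.mem_univ _), ?_⟩
    have h1 := hj ⟨_, ex_add c i, hI⟩
    have h2 : (i : ℝ) = j ⟨_, ex_add c i, hI⟩ := by
      have : 2 * Real.pi * (i : ℝ) = 2 * Real.pi * j ⟨_, ex_add c i, hI⟩ := by linarith
      exact mul_left_cancel₀ (by positivity) this
    exact_mod_cast h2.symm
  · intro a _
    congr 1
    exact hj a

/-! ### The morphisms defined by split data -/

namespace SplitData

variable {F : Sh k circle.{u}} {I : Set ℝ} (D : SplitData F I)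

theorem exists_toPush (U : Opens circle.{u}) (σ : Sec F U) :
    ∃ φ : Sec (pushInterval k I) U, ∀ c (h : ex c ∈ U), ival h φ = D.t c (grm F h σ) := by
  refine exists_pushInterval (fun c h => D.t c (grm F h σ)) ?_ ?_
  · intro c h hc
    filter_upwards [D.t_local U σ c h] with c' hc' h'
    rcases hc' h' with h1 | h1
    · exact absurd h1.1 hc
    · rw [h1, D.t_zero c hc]
      rfl
  · intro c h hc
    filter_upwards [D.t_local U σ c h] with c' hc' hI h'
    rcases hc' h' with h1 | h1
    · exact absurd hI h1.2
    · exact h1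

/-- The action of the morphism `F ⟶ e_* k_I` on sections. -/
def toPushSec (U : Opens circle.{u}) : Sec F U →ₗ[k] Sec (pushInterval k I) U where
  toFun σ := (D.exists_toPush U σ).choose
  map_add' σ τ := pushInterval_ext fun c h => by
    rw [map_add, (D.exists_toPush U _).choose_spec, (D.exists_toPush U σ).choose_spec,
      (D.exists_toPush U τ).choose_spec, map_add, map_add]
  map_smul' a σ := pushInterval_ext fun c h => by
    rw [map_smul, (D.exists_toPush U _).choose_spec, (D.exists_toPush U σ).choose_spec, map_smul,
      map_smul]
    rfl

theorem ival_toPushSec {U : Opens circle.{u}} (σ : Sec F U) {c : ℝ} (h : ex c ∈ U) :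
    ival h (D.toPushSec U σ) = D.t c (grm F h σ) := (D.exists_toPush U σ).choose_spec c h

/-- The morphism `F ⟶ e_* k_I`. -/
def toPush : F ⟶ pushInterval k I :=
  mkHom D.toPushSec fun U V hUV σ => pushInterval_ext fun c h => by
    rw [ival_res, ival_toPushSec, ival_toPushSec, grm_res]

variable {R : ℝ} (hR : I ⊆ Set.Icc (-R) R)

/-- The germ at `x` of the image in `F` of a section of `e_* k_I`. -/
def fromPushGerm {U : Opens circle.{u}} (φ : Sec (pushInterval k I) U) (x : circle.{u}) (hx : x ∈ U) :
    Stalk F x :=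
  letI := finite_fibre hR x
  letI := Fintype.ofFinite (Fibre I x)
  ∑ a : Fibre I x, ival (mem_of_ex_eq a.2.1 hx) φ • castStalk F a.2.1 (D.s a.1)

/-- Near `c` the product of a section of `e_* k_I` with `s` is given by a section of `F`. -/
theorem exists_local_product {U : Opens circle.{u}} (φ : Sec (pushInterval k I) U) (c : ℝ)
    (hc : ex c ∈ U) : ∃ (W : Opens circle.{u}) (_ : ex c ∈ W) (τ : Sec F W),
      ∀ᶠ c' in 𝓝 c, ∀ (h : ex c' ∈ W) (h' : ex c' ∈ U), grm F h τ = ival h' φ • D.s c' := by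
  by_cases hI : c ∈ I
  · obtain ⟨W, hcW, σ, hσ⟩ := D.s_local c hI
    refine ⟨W, hcW, ival hc φ • σ, ?_⟩
    filter_upwards [hσ, ival_eventually_eq φ hc hI] with c' h1 h2 h h'
    rw [map_smul, h1 h]
    -- Outside `I` the value of `φ` may have jumped, but there `s` vanishes.
    by_cases hI' : c' ∈ I
    · rw [h2 hI' h']
    · rw [D.s_zero c' hI', smul_zero, smul_zero]
  · refine ⟨⊤, Opens.mem_top _, 0, ?_⟩
    filter_upwards [ival_eventually_zero φ hc hI] with c' h1 h h'
    rw [h1 h', zero_smul, map_zero]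

theorem exists_fromPush (U : Opens circle.{u}) (φ : Sec (pushInterval k I) U) :
    ∃ σ : Sec F U, ∀ x (hx : x ∈ U), grm F hx σ = D.fromPushGerm hR φ x hx := by
  have hp := Real.pi_pos
  refine exists_sec_of_grm F _ fun x hx => ?_
  obtain ⟨c, rfl⟩ := ex_surjective x
  have hcj : ∀ j : ℤ, ex (c + 2 * Real.pi * j) ∈ U := fun j => by rwa [ex_add]
  choose W hcW τ hτ using fun j : ℤ => D.exists_local_product φ (c + 2 * Real.pi * j) (hcj j)
  -- The bounds are enlarged by `1` so that `J` captures every translate into `I` of every point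
  -- within distance `1` of `c`.
  let J : Finset ℤ := Finset.Icc ⌈(-R - 1 - c) / (2 * Real.pi)⌉ ⌊(R + 1 - c) / (2 * Real.pi)⌋
  have hJ : ∀ c', |c' - c| < 1 → ∀ j : ℤ, c' + 2 * Real.pi * j ∈ I → j ∈ J := by
    intro c' hc' j hj
    obtain ⟨h1, h2⟩ := hR hj
    rw [abs_lt] at hc'
    rw [Finset.mem_Icc, Int.ceil_le, Int.le_floor, div_le_iff₀ (by positivity),
      le_div_iff₀ (by positivity)]
    constructor <;> linarith
  have hev : ∀ᶠ c' in 𝓝 c, |c' - c| < 1 ∧ ex c' ∈ U ∧ ∀ j ∈ J, ex c' ∈ W j ∧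
      ∀ (h : ex (c' + 2 * Real.pi * j) ∈ W j) (h' : ex (c' + 2 * Real.pi * j) ∈ U),
        grm F h (τ j) = ival h' φ • D.s (c' + 2 * Real.pi * j) := by
    refine Filter.Eventually.and ?_ ((eventually_ex_mem hx).and ?_)
    · have : Filter.Tendsto (fun c' => |c' - c|) (𝓝 c) (𝓝 |c - c|) := by
        apply Continuous.tendsto
        fun_prop
      exact this.eventually (eventually_lt_nhds (by simp))
    · rw [Filter.eventually_all_finset]
      intro j _
      refine (eventually_ex_mem (by rw [← ex_add c j]; exact hcW j)).and ?_
      have : Filter.Tendsto (fun c' : ℝ => c' + 2 * Real.pi * j) (𝓝 c) (𝓝 (c + 2 * Real.pi * j)) := by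
        apply Continuous.tendsto
        fun_prop
      exact this.eventually (hτ j)
  obtain ⟨ε, hε, hE⟩ := exists_arc_of_eventually hev
  have hW : ∀ j : J, arc.{u} (c - ε) (c + ε) ≤ W j := by
    rintro j _ ⟨c', hc', rfl⟩
    exact ((hE c' hc').2.2 j j.2).1
  have hU : arc.{u} (c - ε) (c + ε) ≤ U := by
    rintro _ ⟨c', hc', rfl⟩
    exact (hE c' hc').2.1
  refine ⟨arc (c - ε) (c + ε), ex_mem_arc (by linarith) (by linarith), hU,
    ∑ j : J, res F (hW j) (τ j), fun y hy => ?_⟩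
  obtain ⟨c', hc', rfl⟩ := mem_arc.1 hy
  rw [map_sum]
  have h1 : ∀ j : J, grm F hy (res F (hW j) (τ j)) =
      castStalk F (ex_add c' j) (ival (show ex (c' + 2 * Real.pi * j) ∈ U by
        rw [ex_add]; exact hU hy) φ • D.s (c' + 2 * Real.pi * j)) := by
    intro j
    have h2 := ((hE c' hc').2.2 j j.2).2 (by rw [ex_add]; exact hW j hy)
      (by rw [ex_add]; exact hU hy)
    rw [← h2, castStalk_grm, grm_res]
  rw [Finset.sum_congr rfl fun j _ => h1 j]
  let _ := finite_fibre hR (ex.{u} c')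
  let _ := Fintype.ofFinite (Fibre I (ex.{u} c'))
  have h3 := sum_fibre J (hJ c' (hE c' hc').1)
    (fun a ha => ival (mem_of_ex_eq ha (hU hy)) φ • castStalk F ha (D.s a))
    (fun a ha haI => by rw [D.s_zero a haI, map_zero, smul_zero])
  refine Eq.trans ?_ h3.symm
  rw [← Finset.sum_coe_sort J]
  exact Finset.sum_congr rfl fun j _ => map_smul _ _ _

/-- The action of the morphism `e_* k_I ⟶ F` on sections. -/
def fromPushSec (U : Opens circle.{u}) : Sec (pushInterval k I) U →ₗ[k] Sec F U where
  toFun φ := (D.exists_fromPush hR U φ).choose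
  map_add' φ ψ := sec_ext F fun x hx => by
    rw [map_add, (D.exists_fromPush hR U _).choose_spec, (D.exists_fromPush hR U φ).choose_spec,
      (D.exists_fromPush hR U ψ).choose_spec]
    simp only [fromPushGerm, map_add, add_smul, Finset.sum_add_distrib]
  map_smul' a φ := sec_ext F fun x hx => by
    rw [map_smul, (D.exists_fromPush hR U _).choose_spec, (D.exists_fromPush hR U φ).choose_spec]
    simp only [fromPushGerm, map_smul, smul_assoc, Finset.smul_sum, RingHom.id_apply]

theorem grm_fromPushSec {U : Opens circle.{u}} (φ : Sec (pushInterval k I) U) {x : circle.{u}}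
    (hx : x ∈ U) : grm F hx (D.fromPushSec hR U φ) = D.fromPushGerm hR φ x hx :=
  (D.exists_fromPush hR U φ).choose_spec x hx

/-- The morphism `e_* k_I ⟶ F`. -/
def fromPush : pushInterval k I ⟶ F :=
  mkHom (D.fromPushSec hR) fun U V hUV φ => sec_ext F fun x hx => by
    rw [grm_res, grm_fromPushSec, grm_fromPushSec]
    rfl

theorem ival_fromPush_toPush {U : Opens circle.{u}} (φ : Sec (pushInterval k I) U) {c : ℝ}
    (hc : ex c ∈ U) [Fintype (Fibre I (ex.{u} c))] :
    ival hc (D.toPushSec U (D.fromPushSec hR U φ)) = ∑ a : Fibre I (ex.{u} c),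
      ival (mem_of_ex_eq a.2.1 hc) φ * D.t c (castStalk F a.2.1 (D.s a.1)) := by
  rw [ival_toPushSec, grm_fromPushSec, fromPushGerm, map_sum]
  refine Finset.sum_congr (by ext; simp) fun a _ => ?_
  rw [map_smul, smul_eq_mul]

/-- At `c` the composite sums the values of `φ` over the fibre with weights `t c (s a)`: diagonal
weights are one, and weights on one side of the diagonal are zero. As `I` is bounded, the difference
from the identity is nilpotent. -/
theorem fromPush_toPush_bijective (U : Opens circle.{u}) :
    Function.Bijective (D.toPushSec U ∘ₗ D.fromPushSec hR U) := by
  have hp := Real.pi_pos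
  -- The sign `η` treats both directions of triangularity together.
  obtain ⟨η, hη, htri⟩ : ∃ η : ℝ, (η = 1 ∨ η = -1) ∧
      ∀ c c' (h : ex c' = ex c), η * c' < η * c → D.t c (castStalk F h (D.s c')) = 0 := by
    rcases D.triangular with h | h
    · exact ⟨1, Or.inl rfl, fun c c' hcc' hlt => h c c' hcc' (by linarith)⟩
    · exact ⟨-1, Or.inr rfl, fun c c' hcc' hlt => h c c' hcc' (by linarith)⟩
  have hRη : ∀ c ∈ I, -R ≤ η * c ∧ η * c ≤ R := by
    intro c hc
    obtain ⟨h1, h2⟩ := hR hc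
    rcases hη with rfl | rfl <;> constructor <;> linarith
  set u : Module.End k (Sec (pushInterval k I) U) := D.toPushSec U ∘ₗ D.fromPushSec hR U with hu
  -- Only fibre points strictly beyond `c` contribute to `(1 - u) φ`, and they are at least `2π`
  -- beyond; the bound on the support therefore drops by `2π`.
  have hstep : ∀ (b : ℝ) (φ : Sec (pushInterval k I) U),
      (∀ c (h : ex c ∈ U), b < η * c → ival h φ = 0) →
      ∀ c (h : ex c ∈ U), b - 2 * Real.pi < η * c → ival h ((1 - u) φ) = 0 := by
    intro b φ hφ c h hb
    let _ := finite_fibre hR (ex.{u} c)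
    let _ := Fintype.ofFinite (Fibre I (ex.{u} c))
    have h1 : ival h ((1 - u) φ) = ival h φ - ival h (D.toPushSec U (D.fromPushSec hR U φ)) := by
      rw [LinearMap.sub_apply, map_sub]
      rfl
    rw [h1]
    by_cases hI : c ∈ I
    · rw [D.ival_fromPush_toPush, Finset.sum_eq_single (⟨c, rfl, hI⟩ : Fibre I (ex.{u} c))]
      · rw [castStalk_rfl, D.pairing c hI, mul_one, sub_self]
      · rintro ⟨a, ha, haI⟩ - hne
        have hac : a ≠ c := fun h => hne (Subtype.ext h)
        rcases lt_or_ge (η * a) (η * c) with hlt | hge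
        · rw [htri c a ha hlt, mul_zero]
        · rw [hφ a _ ?_, zero_mul]
          obtain ⟨j, rfl⟩ := ex_eq_iff.1 ha.symm
          have hj : j ≠ 0 := by
            rintro rfl
            simp at hac
          rcases hη with rfl | rfl
          · have h3 : (0 : ℝ) ≤ j := by
              by_contra! h'
              nlinarith
            have h4 : (1 : ℤ) ≤ j := by
              have : (0 : ℤ) ≤ j := by exact_mod_cast h3
              omega
            have h5 : (1 : ℝ) ≤ j := by exact_mod_cast h4
            nlinarith
          · have h3 : (j : ℝ) ≤ 0 := by
              by_contra! h'
              nlinarith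
            have h4 : j ≤ (-1 : ℤ) := by
              have : j ≤ (0 : ℤ) := by exact_mod_cast h3
              omega
            have h5 : (j : ℝ) ≤ -1 := by exact_mod_cast h4
            nlinarith
      · intro h'
        exact absurd (Finset.mem_univ _) h'
    · rw [ival_eq_zero φ h hI, ival_eq_zero _ h hI, sub_zero]
  have hpow : ∀ (r : ℕ) (φ : Sec (pushInterval k I) U) (c : ℝ) (h : ex c ∈ U),
      R - 2 * Real.pi * r < η * c → ival h (((1 - u) ^ r) φ) = 0 := by
    intro r φ
    induction r with
    | zero =>
      intro c h hc
      refine ival_eq_zero _ h fun hI => ?_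
      have := (hRη c hI).2
      simp at hc
      linarith
    | succ r ih =>
      intro c h hc
      rw [pow_succ', Module.End.mul_apply]
      refine hstep _ _ ih c h ?_
      push_cast at hc
      linarith
  have hnil : IsNilpotent (1 - u) := by
    -- Enough steps of length `2π` to cross `[-R, R]`, which contains `I`.
    obtain ⟨r, hr⟩ := exists_nat_gt (2 * R / (2 * Real.pi))
    rw [div_lt_iff₀ (by positivity)] at hr
    refine ⟨r, LinearMap.ext fun φ => pushInterval_ext fun c h => ?_⟩
    rw [LinearMap.zero_apply, map_zero]
    by_cases hI : c ∈ I
    · refine hpow r φ c h ?_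
      have := (hRη c hI).1
      linarith
    · exact ival_eq_zero _ h hI
  have hunit : IsUnit u := by
    have := hnil.isUnit_one_sub
    rwa [sub_sub_cancel] at this
  exact (Module.End.isUnit_iff u).1 hunit

/-- Split data on a bounded set define a direct summand. -/
theorem exists_summand (hI : Bornology.IsBounded I) :
    ∃ (G : Sh k circle.{u}) (i : G ⟶ F) (r : F ⟶ G), i ≫ r = 𝟙 G ∧
      Nonempty (F ≅ G ⊞ pushInterval k I) ∧
      ∀ (U : Opens circle.{u}) (σ : Sec G U) (c : ℝ) (h : ex c ∈ U),
        D.t c (grm F h (secMap i U σ)) = 0 := by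
  obtain ⟨R, hR⟩ := hI.subset_closedBall 0
  rw [Real.closedBall_eq_Icc, zero_sub, zero_add] at hR
  have hiso : IsIso (D.fromPush hR ≫ D.toPush) := isIso_of_secMap_bijective _ fun U =>
    D.fromPush_toPush_bijective hR U
  have hsplit : IsSplitEpi D.toPush := IsSplitEpi.mk' ⟨inv (D.fromPush hR ≫ D.toPush) ≫
    D.fromPush hR, by simp⟩
  let b := binaryBiconeOfIsSplitEpiOfKernel (kernelIsKernel D.toPush)
  have hb : b.IsBilimit := isBilimitBinaryBiconeOfIsSplitEpiOfKernel (kernelIsKernel D.toPush)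
  refine ⟨kernel D.toPush, kernel.ι D.toPush, b.fst, b.inl_fst,
    ⟨biprod.uniqueUpToIso _ _ hb⟩, fun U σ c h => ?_⟩
  rw [← D.ival_toPushSec]
  have h1 : D.toPushSec U (secMap (kernel.ι D.toPush) U σ) =
      secMap (kernel.ι D.toPush ≫ D.toPush) U σ := rfl
  rw [h1, kernel.condition]
  rfl

end SplitData

/-! ### The decomposition -/

/-- A biproduct indexed by `Fin (m + 1)` is the biproduct of the first summand and the others. -/
def biproductSuccIso {C : Type*} [Category C] [Preadditive C] [HasFiniteBiproducts C]
    [HasBinaryBiproducts C] {m : ℕ} (g : Fin (m + 1) → C) :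
    ⨁ g ≅ g 0 ⊞ ⨁ fun a : Fin m => g a.succ where
  hom := biprod.lift (biproduct.π g 0) (biproduct.lift fun a => biproduct.π g a.succ)
  inv := biprod.desc (biproduct.ι g 0) (biproduct.desc fun a => biproduct.ι g a.succ)
  hom_inv_id := by
    rw [biprod.lift_desc, biproduct.lift_desc, ← biproduct.total, Fin.sum_univ_succ]
  inv_hom_id := by
    ext a b
    · simp
    · simp [biproduct.ι_π_ne _ (Fin.succ_ne_zero _).symm]
    · simp [biproduct.ι_π_ne _ (Fin.succ_ne_zero _)]
    · simp only [Category.assoc, biprod.inr_desc_assoc, biproduct.ι_desc_assoc, biprod.lift_snd,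
        biproduct.lift_π, biprod.inr_snd_assoc, biproduct.ι_π, Category.comp_id]
      by_cases h : a = b
      · subst h
        simp
      · rw [dif_neg h, dif_neg (fun h' => h (Fin.succ_injective _ h'))]

/-- The total dimension of the spaces of sections over the stars of a grid. -/
def totalRank (Q : Grid) (F : Sh k circle.{u}) : ℕ :=
  ∑ j ∈ Finset.Ico 0 Q.M, Module.finrank k (Sec F (Q.star j))

theorem isBoundedInterval_idx (Q : Grid) {a b : ℤ} (hab : a ≤ b) :
    IsBoundedInterval {c | a ≤ Q.idx c ∧ Q.idx c ≤ b} where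
  nonempty := ⟨Q.q a, by simpa [Q.idx_q] using hab⟩
  ordConnected := ⟨fun c hc d hd x hx =>
    ⟨hc.1.trans (Q.idx_mono hx.1), (Q.idx_mono hx.2).trans hd.2⟩⟩
  isBounded := by
    refine (Metric.isBounded_Icc (Q.q (a - 1)) (Q.q (b + 1))).subset ?_
    rintro c ⟨h1, h2⟩
    have h3 := Q.cell_idx c
    exact ⟨(Q.strictMono.monotone (by omega)).trans h3.1.le,
      h3.2.1.le.trans (Q.strictMono.monotone (by omega))⟩

/-- A sheaf adapted to a grid is locally constant or has a direct summand `e_* k_I`. -/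
theorem Adapted.exists_summand {Q : Grid} {F : Sh k circle.{u}} (hF : Adapted Q F)
    (hL : ¬ IsLocallyConstantOfFiniteRank F) :
    ∃ (G : Sh k circle.{u}) (I : Set ℝ), Adapted Q G ∧ totalRank Q G < totalRank Q F ∧
      IsBoundedInterval I ∧ Nonempty (F ≅ G ⊞ pushInterval k I) := by
  obtain ⟨i, n, x, t, hs⟩ := hF.exists_isString_or_isLocallyConstant.resolve_left hL
  obtain ⟨D⟩ := hs.exists_splitData hF
  have hI := isBoundedInterval_idx Q hs.le
  obtain ⟨G, ι, r, hir, hiso, hker⟩ := D.exists_summand hI.isBounded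
  refine ⟨G, _, hF.of_retract hir, ?_, hI, hiso⟩
  have hfin := hF.fin
  have hle : ∀ j, Module.finrank k (Sec G (Q.star j)) ≤ Module.finrank k (Sec F (Q.star j)) :=
    fun j => LinearMap.finrank_le_finrank_of_injective (secMap_injective_of_retract hir (Q.star j))
  -- The section over the star `i + 1` with germ `s` pairs to one with `t`, whereas sections coming
  -- from `G` pair to zero, so the rank drops strictly there.
  have hlt : Module.finrank k (Sec G (Q.star (i + 1))) <
      Module.finrank k (Sec F (Q.star (i + 1))) := by
    have h1 := LinearMap.finrank_range_of_inj (secMap_injective_of_retract hir (Q.star (i + 1)))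
    rw [← h1]
    refine Submodule.finrank_lt fun htop => ?_
    have hc := Q.cell_q (i + 1)
    obtain ⟨σ, hσ⟩ := (hF.star_bijective hc).2 (D.s (Q.q (i + 1)))
    obtain ⟨τ, rfl⟩ : σ ∈ LinearMap.range (secMap ι (Q.star (i + 1))) := htop ▸ Submodule.mem_top
    have h2 := D.pairing (Q.q (i + 1)) (by simpa [Q.idx_q] using hs.le)
    rw [← hσ, hker] at h2
    exact zero_ne_one h2
  refine Finset.sum_lt_sum (fun j _ => hle j) ⟨(i + 1) % Q.M, ?_, ?_⟩
  · exact Finset.mem_Ico.2 ⟨Int.emod_nonneg _ Q.M_pos.ne', Int.emod_lt_of_pos _ Q.M_pos⟩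
  · have h3 : Q.star.{u} ((i + 1) % Q.M) = Q.star (i + 1) := by
      rw [← Q.star_add _ ((i + 1) / Q.M), Int.emod_add_mul_ediv]
    rwa [h3]

/-- Strong induction on the total rank over one period; every summand split off has multiplicity
one. -/
theorem Adapted.exists_decomposition {Q : Grid} (d : ℕ) : ∀ {F : Sh k circle.{u}}, Adapted Q F →
    totalRank Q F ≤ d →
    ∃ (L : Sh k circle.{u}) (m : ℕ) (I : Fin m → Set ℝ) (n : Fin m → ℕ),
      IsLocallyConstantOfFiniteRank L ∧ (∀ a, IsBoundedInterval (I a)) ∧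
      Nonempty (F ≅ L ⊞ ⨁ fun a => (eDirectImage k).obj (intervalSheaf k (I a) (n a))) := by
  induction d using Nat.strong_induction_on with
  | _ d ih =>
    intro F hF hd
    by_cases hL : IsLocallyConstantOfFiniteRank F
    · refine ⟨F, 0, Fin.elim0, Fin.elim0, hL, fun a => a.elim0, ⟨?_⟩⟩
      have hz : IsZero (⨁ fun a : Fin 0 =>
          (eDirectImage k).obj (intervalSheaf k (a.elim0 : Set ℝ) a.elim0)) := by
        rw [IsZero.iff_id_eq_zero]
        ext a
        exact a.elim0
      exact isoBiprodZero hz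
    · obtain ⟨G, J, hG, hlt, hJ, ⟨i⟩⟩ := hF.exists_summand hL
      obtain ⟨L, m, I, n, hL', hI, ⟨j⟩⟩ := ih _ (hlt.trans_le hd) hG le_rfl
      refine ⟨L, m + 1, Fin.cons J I, Fin.cons 1 n, hL', fun a => ?_, ⟨?_⟩⟩
      · refine Fin.cases hJ hI a
      · let g : Fin (m + 1) → Sh k circle.{u} := fun a =>
          (eDirectImage k).obj (intervalSheaf k ((Fin.cons J I : Fin (m + 1) → Set ℝ) a)
            ((Fin.cons 1 n : Fin (m + 1) → ℕ) a))
        let i' : pushInterval k J ⊞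
          (⨁ fun a => (eDirectImage k).obj (intervalSheaf k (I a) (n a))) ≅ ⨁ g :=
          (biproductSuccIso g).symm
        exact i ≪≫ biprod.mapIso j (Iso.refl _) ≪≫ biprod.associator _ _ _ ≪≫
          biprod.mapIso (Iso.refl _) (biprod.braiding _ _ ≪≫ i')

end

end CircleSheaf

theorem mainTheorem6 {k : Type*} [Field k] (F : CircleSheaf.Sh k CircleSheaf.circle)
    (hF : CircleSheaf.IsConstructible F) :
    ∃ (L : CircleSheaf.Sh k CircleSheaf.circle) (m : ℕ) (I : Fin m → Set ℝ) (n : Fin m → ℕ),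
      CircleSheaf.IsLocallyConstantOfFiniteRank L ∧
      (∀ a, CircleSheaf.IsBoundedInterval (I a)) ∧
      Nonempty (F ≅ L ⊞ ⨁ fun a =>
        (CircleSheaf.eDirectImage k).obj (CircleSheaf.intervalSheaf k (I a) (n a))) := by
  obtain ⟨Q, hQ⟩ := CircleSheaf.IsConstructible.exists_adapted hF
  exact hQ.exists_decomposition _ le_rfl
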